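/- Let $G=(V,E)$ be a finite connected graph, loops and multiple edges being allowed. For a length vector $\vec l=(l_e)_{e\in E}\in\,]0,+\infty[^E$ let $|G|$ be the metric graph obtained by gluing the intervals $[-l_e/2,l_e/2]$, $e\in E$, at their end points as prescribed by an (arbitrarily chosen) orientation of the edges of $G$; let $t_e$ be the arc-length coordinate on the edge $e$ and $|dt_e|$ its Riemannian measure. Let $\Delta_{\vec l}$ be the Laplacian: its domain consists of the continuous functions $\phi:|G|\to\mathbb C$ which are in the Sobolev space $H^2$ on each edge and whose outgoing derivatives sum to $0$ at every vertex, and $\Delta_{\vec l}\phi=-d^2\phi/dt_e^2$ on each edge $e$. A semi-classical measure of $(G,\vec l)$ is a non-zero weak limit of a sequence of measures $\sum_{e\in E}|\phi_j(t_e)|^2\,|dt_e|$ on $|G|$, where the $\phi_j$ are non-zero (not necessarily normalized) eigenfunctions of $\Delta_{\vec l}$ with eigenvalues $k_j^2\to+\infty$. Call $\vec l$ irrational if its components are linearly independent over $\mathbb Q$. The set of irrational $\vec l$ is Baire generic (residual) in $]0,+\infty[^E$, and for every irrational $\vec l$ the following holds. 1. A subset $K\subset|G|$ is minimal (for inclusion)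 among the supports of semi-classical measures of $(G,\vec l)$ if and only if $K$ is the union of the (closed) edges of a simple cycle of $G$ or of a simple path of $G$ joining two distinct vertices of degree $1$. (A loop is a simple cycle, and so is a pair of parallel edges; in the degree a loop counts twice.) 2. Let $\gamma$ be the set of edges of such a simple cycle or simple path. The only semi-classical measure of total mass $1$ whose support is the union of the edges of $\gamma$ is the uniform probability measure $\mu_\gamma=\big(\sum_{e\in\gamma}l_e\big)^{-1}\sum_{e\in\gamma}|dt_e|$ (in particular $\mu_\gamma$ is a semi-classical measure), and $\mu_\gamma$ is an extremal point of the convex hull of the set of all semi-classical measures of total mass $1$. -/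

import Mathlib

open MeasureTheory Filter Topology
open scoped NNReal ENNReal

/-- A graph with vertex set `V` and edge set `E`, loops and multiple edges allowed, together with
a choice of an orientation of the edges: `e` runs from `src e` to `tgt e`. -/
structure OrientedMultigraph (V E : Type*) where
  src : E → V
  tgt : E → V

/-- The space `]0, +∞[ ^ E` of length vectors, with its product topology. -/
abbrev Lengths (E : Type*) := E → Set.Ioi (0 : ℝ)

/-- A length vector is irrational if its components are linearly independent over `ℚ`. -/
def Lengths.IsIrrational {E : Type*} (l : Lengths E) : Prop :=
  LinearIndependent ℚ (fun e => (l e : ℝ))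

namespace OrientedMultigraph

variable {V E : Type*} (G : OrientedMultigraph V E)

/-! ### Combinatorics -/

/-- The edge `e` joins `u` and `w` (in one of the two directions). -/
def Joins (e : E) (u w : V) : Prop :=
  (G.src e = u ∧ G.tgt e = w) ∨ (G.src e = w ∧ G.tgt e = u)

/-- Connectedness; loops and multiplicities play no role, so this is connectedness of the
underlying simple graph (which includes that there is at least one vertex). -/
def IsConnected : Prop :=
  (SimpleGraph.fromRel (fun u w : V => ∃ e, G.Joins e u w)).Connected

/-- The degree of a vertex: the number of half-edges at it (a loop counts twice). -/
noncomputable def degree (v : V) : ℕ :=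
  Nat.card {e // G.src e = v} + Nat.card {e // G.tgt e = v}

/-- `γ` is the edge set of a simple cycle: there are `n + 1` distinct vertices and `n + 1` distinct
edges, the `i`-th edge joining the `i`-th vertex to the next one, cyclically (addition in
`Fin (n + 1)` is modulo `n + 1`).  A loop is a simple cycle (`n = 0`), and so are two parallel
edges (`n = 1`). -/
def IsSimpleCycle (γ : Finset E) : Prop :=
  ∃ (n : ℕ) (v : Fin (n + 1) → V) (e : Fin (n + 1) → E),
    Function.Injective v ∧ Function.Injective e ∧
      (∀ i, G.Joins (e i) (v i) (v (i + 1))) ∧ (γ : Set E) = Set.range e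

/-- `γ` is the edge set of a simple path joining two (different) vertices of degree `1`: there are
`n + 2` distinct vertices, consecutive ones are joined by the edges of `γ`, and the first and the
last vertex have degree `1` in `G`. -/
def IsSimpleLeafPath (γ : Finset E) : Prop :=
  ∃ (n : ℕ) (v : Fin (n + 2) → V) (e : Fin (n + 1) → E),
    Function.Injective v ∧ (∀ i, G.Joins (e i) (v i.castSucc) (v i.succ)) ∧
      G.degree (v 0) = 1 ∧ G.degree (v (Fin.last (n + 1))) = 1 ∧ (γ : Set E) = Set.range e

/-! ### The metric graph -/

/-- The closed interval `[-l_e/2, l_e/2]` that parametrizes the edge `e` by arc length. -/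
abbrev EdgeInterval (l : Lengths E) (e : E) : Type :=
  Set.Icc (-(l e : ℝ) / 2) ((l e : ℝ) / 2)

lemma half_nonneg (l : Lengths E) (e : E) : -(l e : ℝ) / 2 ≤ (l e : ℝ) / 2 := by
  have := (l e).2
  simp only [Set.mem_Ioi] at this
  linarith

/-- The initial point of the parametrizing interval. -/
noncomputable def leftEnd (l : Lengths E) (e : E) : EdgeInterval l e :=
  ⟨-(l e : ℝ) / 2, Set.left_mem_Icc.2 (half_nonneg l e)⟩

/-- The final point of the parametrizing interval. -/
noncomputable def rightEnd (l : Lengths E) (e : E) : EdgeInterval l e :=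
  ⟨(l e : ℝ) / 2, Set.right_mem_Icc.2 (half_nonneg l e)⟩

/-- The point `p` of the disjoint union of the intervals is an end point sitting at the
vertex `v`. -/
def EndsAt (l : Lengths E) (p : Σ e, EdgeInterval l e) (v : V) : Prop :=
  ((p.2 : ℝ) = -(l p.1 : ℝ) / 2 ∧ G.src p.1 = v) ∨ ((p.2 : ℝ) = (l p.1 : ℝ) / 2 ∧ G.tgt p.1 = v)

lemma EndsAt.unique {G : OrientedMultigraph V E} {l : Lengths E} {p : Σ e, EdgeInterval l e}
    {v w : V} (hv : G.EndsAt l p v) (hw : G.EndsAt l p w) : v = w := by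
  have hl : (0 : ℝ) < l p.1 := (l p.1).2
  rcases hv with ⟨h1, rfl⟩ | ⟨h1, rfl⟩ <;> rcases hw with ⟨h2, rfl⟩ | ⟨h2, rfl⟩
  · rfl
  · linarith
  · linarith
  · rfl

/-- The gluing: end points sitting at the same vertex are identified. -/
def gluing (l : Lengths E) : Setoid (Σ e, EdgeInterval l e) where
  r p q := p = q ∨ ∃ v, G.EndsAt l p v ∧ G.EndsAt l q v
  iseqv :=
    { refl := fun _ => Or.inl rfl
      symm := by
        rintro p q (rfl | ⟨v, hp, hq⟩)
        · exact Or.inl rfl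
        · exact Or.inr ⟨v, hq, hp⟩
      trans := by
        rintro p q r (rfl | ⟨v, hp, hq⟩) (rfl | ⟨w, hq', hr⟩)
        · exact Or.inl rfl
        · exact Or.inr ⟨w, hq', hr⟩
        · exact Or.inr ⟨v, hp, hq⟩
        · obtain rfl := hq.unique hq'
          exact Or.inr ⟨v, hp, hr⟩ }

/-- The topological space `|G|`, obtained by gluing the intervals `[-l_e/2, l_e/2]`. -/
def Realization (l : Lengths E) : Type _ := Quotient (G.gluing l)

instance (l : Lengths E) : TopologicalSpace (G.Realization l) :=
  inferInstanceAs (TopologicalSpace (Quotient (G.gluing l)))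

instance (l : Lengths E) : MeasurableSpace (G.Realization l) := borel _

instance (l : Lengths E) : BorelSpace (G.Realization l) := ⟨rfl⟩

/-- The arc-length parametrization of the closed edge `e` in `|G|`. -/
def edgeMap (l : Lengths E) (e : E) (t : EdgeInterval l e) : G.Realization l :=
  Quotient.mk (G.gluing l) ⟨e, t⟩

/-- The subset of `|G|` carried by a set of (closed) edges. -/
def carrier (l : Lengths E) (γ : Finset E) : Set (G.Realization l) :=
  ⋃ e ∈ γ, Set.range (G.edgeMap l e)

lemma continuous_edgeMap (l : Lengths E) (e : E) : Continuous (G.edgeMap l e) :=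
  continuous_quotient_mk'.comp (continuous_sigmaMk (σ := fun e => EdgeInterval l e))

lemma measurable_edgeMap (l : Lengths E) (e : E) : Measurable (G.edgeMap l e) :=
  (G.continuous_edgeMap l e).measurable

/-- Lebesgue measure on the interval `[-l_e/2, l_e/2]`. -/
noncomputable def intervalMeasure (l : Lengths E) (e : E) : Measure (EdgeInterval l e) :=
  Measure.comap Subtype.val (volume : Measure ℝ)

lemma intervalMeasure_univ (l : Lengths E) (e : E) :
    intervalMeasure l e Set.univ = ENNReal.ofReal (l e) := by
  rw [intervalMeasure, (MeasurableEmbedding.subtype_coe measurableSet_Icc).comap_apply]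
  rw [Set.image_univ, Subtype.range_coe, Real.volume_Icc]
  congr 1
  ring

/-- The Riemannian measure `|dt_e|` of the edge `e`, as a measure on `|G|`. -/
noncomputable def edgeMeasure (l : Lengths E) (e : E) : FiniteMeasure (G.Realization l) :=
  ⟨Measure.map (G.edgeMap l e) (intervalMeasure l e), by
    have : IsFiniteMeasure (intervalMeasure l e) :=
      ⟨by rw [intervalMeasure_univ]; exact ENNReal.ofReal_lt_top⟩
    infer_instance⟩

/-- The Riemannian measure `∑ |dt_e|`, the sum being over the edges in `γ`. -/
noncomputable def subgraphMeasure (l : Lengths E) (γ : Finset E) :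
    FiniteMeasure (G.Realization l) :=
  ∑ e ∈ γ, G.edgeMeasure l e

/-- The uniform probability measure on the union of the edges in `γ` (for nonempty `γ`). -/
noncomputable def uniformMeasure (l : Lengths E) (γ : Finset E) :
    FiniteMeasure (G.Realization l) :=
  (G.subgraphMeasure l γ).mass⁻¹ • G.subgraphMeasure l γ

/-! ### The Laplacian and semi-classical measures -/

section Laplacian

variable [Fintype E]

open Classical in
/-- `φ` lies in the domain of the Laplacian of `(G, l)`, and `Δ φ = ψ` (almost everywhere).
On each edge, `φ` is in the Sobolev space `H²`: `φ` is a primitive of `g e`, which is a primitive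
of a square-integrable function `h e` (so `g e` and `h e` are the first and the second weak
derivative); `φ` is continuous on `|G|`; at each vertex the outgoing derivatives sum to zero; and
`ψ = - h e` almost everywhere on each edge `e`. -/
def IsLaplacian (l : Lengths E) (φ ψ : G.Realization l → ℂ) : Prop :=
  Continuous φ ∧ ∃ g h : E → ℝ → ℂ,
    (∀ e, MemLp (h e) 2 (volume.restrict (Set.Icc (-(l e : ℝ) / 2) ((l e : ℝ) / 2)))) ∧
    (∀ e, ∀ t : EdgeInterval l e,
      g e t = g e (-(l e : ℝ) / 2) + ∫ s in (-(l e : ℝ) / 2)..t, h e s) ∧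
    (∀ e, ∀ t : EdgeInterval l e,
      φ (G.edgeMap l e t) =
        φ (G.edgeMap l e (leftEnd l e)) + ∫ s in (-(l e : ℝ) / 2)..t, g e s) ∧
    (∀ v, ∑ e with G.src e = v, g e (-(l e : ℝ) / 2)
        + ∑ e with G.tgt e = v, -g e ((l e : ℝ) / 2) = 0) ∧
    (∀ e, ∀ᵐ t ∂intervalMeasure l e, ψ (G.edgeMap l e t) = -h e t)

/-- `φ` is a (non-zero) eigenfunction of the Laplacian of `(G, l)` with eigenvalue `lam`. -/
def IsEigenfunction (l : Lengths E) (lam : ℝ) (φ : G.Realization l → ℂ) : Prop :=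
  φ ≠ 0 ∧ G.IsLaplacian l φ (fun x => lam * φ x)

/-- The measure `∑_e |φ(t_e)|² |dt_e|` on `|G|`. -/
noncomputable def eigenMeasure (l : Lengths E) (φ : G.Realization l → ℂ) :
    Measure (G.Realization l) :=
  (G.subgraphMeasure l Finset.univ : Measure (G.Realization l)).withDensity
    (fun x => ‖φ x‖ₑ ^ 2)

/-- The semi-classical measures of `(G, l)`: the non-zero weak limits of measures `|φ_j|² |dx|`,
where the `φ_j` are eigenfunctions, not necessarily normalized, with eigenvalues `k_j ^ 2 → +∞`. -/
def semiclassicalMeasures (l : Lengths E) : Set (FiniteMeasure (G.Realization l)) :=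
  {μ | μ ≠ 0 ∧ ∃ (k : ℕ → ℝ) (φ : ℕ → G.Realization l → ℂ)
      (ν : ℕ → FiniteMeasure (G.Realization l)),
    (∀ j, G.IsEigenfunction l (k j ^ 2) (φ j)) ∧
    Tendsto (fun j => k j ^ 2) atTop atTop ∧
    (∀ j, (ν j : Measure (G.Realization l)) = G.eigenMeasure l (φ j)) ∧
    Tendsto ν atTop (𝓝 μ)}

/-- The semi-classical measures of total mass `1`. -/
def semiclassicalProbabilities (l : Lengths E) : Set (FiniteMeasure (G.Realization l)) :=
  {μ | μ ∈ G.semiclassicalMeasures l ∧ μ.mass = 1}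

/-- `K` is the topological support of some semi-classical measure. -/
def IsSemiclassicalSupport (l : Lengths E) (K : Set (G.Realization l)) : Prop :=
  ∃ μ ∈ G.semiclassicalMeasures l, (μ : Measure (G.Realization l)).support = K

end Laplacian

end OrientedMultigraph

/-!
A function on the metric graph which solves `-φ'' = k² φ` on the edges is, on each edge `e`, the sum
of two progressive waves. It is described by the amplitudes `x h` with which these waves leave the
half-edges `h`. Continuity and Kirchhoff's condition at the vertices are linear equations for `x`
(`VertexConditions`, or the kernel of `secularMatrix`), which depend on `k` and on the lengths only
through the phases `z e = exp (i k l_e)`, a point of a torus. They make sense for all phases `z`.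

*Upper bound for the supports.* By the Riemann–Lebesgue lemma, the two waves on an edge do not
interfere in the limit `k → ∞`. Therefore every semi-classical measure is of the form
`∑ intensity x e |dt_e|`, where `x ≠ 0` satisfies the vertex conditions for some limit `z` of
phases, and `intensity x e` is the sum of the squared moduli of the two amplitudes on `e`
(`exists_intensity_of_mem_semiclassicalMeasures`). If such an `x` vanishes on all the edges at a
vertex except for one half-edge, and if the degree of the vertex is not `1`, the Cauchy data vanish
on that half-edge too: the support of `x` has no dead ends besides the vertices of degree `1`. Hence
it contains a simple cycle or a simple path between two such vertices
(`exists_cycle_or_leafPath_subset`). If it is contained in such a cycle or path `γ`, the wave passes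
from each edge to the next one without reflection, so that its intensity is constant on `γ`
(`IsChain.exists_intensity_eq`), and the measure is a multiple of the uniform one.

*Realization.* Let `γ` be a simple cycle or a simple path between vertices of degree `1`. There is
a wave supported in `γ` for suitable phases on `γ` (`IsChain.exists_vertexConditions`), whatever the
phases of the other edges are. It has to be shown that for some choice of the latter *all* the waves
are supported in `γ`, and that the phases `z` obtained can be approximated by those of genuine
eigenfunctions. Since limits of the latter are waves for the phases `z`, they are then carried by
`γ`, and uniform there. Both steps rest on the conservation of the flux
(`VertexConditions.sum_flux`), which makes waves disappear on edges with `‖z e‖ < 1`.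

* If the phases outside `γ` are replaced by a common complex number `ζ`, then for `ζ = 0`, by
  absorption, all the waves are supported in `γ`; in this case they are waves for every `ζ`. The set
  of all `ζ` for which there are no other waves contains the complement of the zeros of a polynomial
  in `ζ`, which is not zero at `ζ = 0`; by the maximum principle, it contains a point of the unit
  circle (`exists_norm_eq_one_ker_eq`, `exists_phases_edgeSupport_subset`).
* When the lengths are independent over `ℚ`, the phases `exp (i k l_e)` approach `z` for arbitrarily
  large `k`, by Kronecker's theorem (`frequently_exp_mem`). The determinant of the secular matrix,
  as a function of a complex shift `s` of the frequency, has only real zeros, again by conservation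
  of the flux. It vanishes at `s = 0` for the phases `z`; so by a form of Hurwitz's theorem
  (`eventually_exists_zero`) it has a zero close to `0` for phases close to `z`, and this zero is
  real: it provides an eigenfunction (`frequently_vertexConditions`).

*Extremality.* A convex combination with positive weights that does not charge the complement of `γ`
combines measures with the same property, and the only semi-classical probability measure of this
kind is the uniform one (`IsChain.uniformMeasure_mem_extremePoints`).

*Genericity.* The irrational length vectors are the complement of countably many hyperplanes.
-/

/-! ### Kronecker's theorem for linear flows on tori -/

section Kronecker

variable {E : Type*}

/-- The linear flow `t ↦ t ω` on the torus `(ℝ/ℤ)^E`. -/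
noncomputable def torusFlow (ω : E → ℝ) (t : ℝ) : UnitAddTorus E :=
  fun e => ((t * ω e : ℝ) : UnitAddCircle)

lemma continuous_torusFlow (ω : E → ℝ) : Continuous (torusFlow ω) := by
  refine continuous_pi fun e => ?_
  exact (AddCircle.continuous_mk' 1).comp (by fun_prop)

/-- The time average over `[0, T]` of a function along the flow. -/
noncomputable def flowMean (ω : E → ℝ) (F : C(UnitAddTorus E, ℂ)) (T : ℝ) : ℂ :=
  (T : ℂ)⁻¹ * ∫ t in (0 : ℝ)..T, F (torusFlow ω t)

lemma flowMean_eq (ω : E → ℝ) (F : C(UnitAddTorus E, ℂ)) :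
    flowMean ω F = fun T : ℝ => (T : ℂ)⁻¹ * ∫ t in (0 : ℝ)..T, F (torusFlow ω t) := rfl

lemma continuous_comp_torusFlow (ω : E → ℝ) (F : C(UnitAddTorus E, ℂ)) :
    Continuous fun t => F (torusFlow ω t) :=
  F.continuous.comp (continuous_torusFlow ω)

variable [Fintype E]

/-- The normalized Haar measure of the torus `(ℝ/ℤ)^E`. -/
noncomputable def torusHaar (E : Type*) [Fintype E] : Measure (UnitAddTorus E) :=
  Measure.pi fun _ : E => (AddCircle.haarAddCircle : Measure UnitAddCircle)

instance : IsProbabilityMeasure (torusHaar E) := by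
  unfold torusHaar; infer_instance

instance : Measure.IsOpenPosMeasure (torusHaar E) := by
  unfold torusHaar; infer_instance

lemma integral_mFourier_eq_zero {n : E → ℤ} (hn : n ≠ 0) :
    ∫ y, UnitAddTorus.mFourier n y ∂torusHaar E = 0 := by
  obtain ⟨e, he⟩ := Function.ne_iff.1 hn
  have h : ∫ y, UnitAddTorus.mFourier n y ∂torusHaar E
      = ∏ e, ∫ y, fourier (n e) y ∂(AddCircle.haarAddCircle : Measure UnitAddCircle) :=
    integral_fintype_prod_eq_prod (fun e (y : UnitAddCircle) => (fourier (n e) y : ℂ))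
  rw [h]
  refine Finset.prod_eq_zero (Finset.mem_univ e) ?_
  have hadd := fourier_add_half_inv_index (T := 1) (n := n e) he one_pos
  exact integral_eq_zero_of_add_right_eq_neg (μ := AddCircle.haarAddCircle) hadd

lemma mFourier_torusFlow (ω : E → ℝ) (n : E → ℤ) (t : ℝ) :
    UnitAddTorus.mFourier n (torusFlow ω t)
      = Complex.exp ((2 * Real.pi * (∑ e, n e * ω e) : ℝ) * Complex.I * t) := by
  simp only [UnitAddTorus.mFourier, torusFlow, ContinuousMap.coe_mk, fourier_coe_apply]
  rw [← Complex.exp_sum]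
  congr 1
  push_cast
  rw [Finset.mul_sum, Finset.sum_mul, Finset.sum_mul]
  refine Finset.sum_congr rfl fun e _ => ?_
  ring

lemma tendsto_mean_exp {c : ℝ} (hc : c ≠ 0) :
    Tendsto (fun T : ℝ => (T : ℂ)⁻¹ * ∫ t in (0 : ℝ)..T, Complex.exp (c * Complex.I * t))
      atTop (𝓝 0) := by
  have hcI : (c : ℂ) * Complex.I ≠ 0 := by simp [hc]
  rw [tendsto_zero_iff_norm_tendsto_zero]
  have hlim : Tendsto (fun T : ℝ => T⁻¹ * (2 / |c|)) atTop (𝓝 0) := by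
    simpa using tendsto_inv_atTop_zero.mul_const (2 / |c|)
  refine squeeze_zero' (Eventually.of_forall fun _ => norm_nonneg _) ?_ hlim
  filter_upwards [eventually_gt_atTop 0] with T hT
  rw [integral_exp_mul_complex hcI, norm_mul, norm_inv, norm_div, Complex.norm_real,
    Real.norm_of_nonneg hT.le]
  gcongr
  · refine (norm_sub_le _ _).trans ?_
    have h1 : ∀ s : ℝ, ‖Complex.exp (c * Complex.I * s)‖ = 1 := fun s => by
      rw [show (c : ℂ) * Complex.I * s = ((c * s : ℝ) : ℂ) * Complex.I by push_cast; ring]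
      exact Complex.norm_exp_ofReal_mul_I _
    rw [h1, h1]; norm_num
  · simp

/-- Time averages converge to the space average, when the frequencies are independent over `ℚ`. -/
lemma tendsto_flowMean {ω : E → ℝ} (hω : LinearIndependent ℚ ω) (F : C(UnitAddTorus E, ℂ)) :
    Tendsto (flowMean ω F) atTop (𝓝 (∫ y, F y ∂torusHaar E)) := by
  have hint : ∀ F : C(UnitAddTorus E, ℂ), Integrable F (torusHaar E) := fun F =>
    F.continuous.integrable_of_hasCompactSupport (HasCompactSupport.of_compactSpace F)
  have hspan : ∀ P ∈ Submodule.span ℂ (Set.range (UnitAddTorus.mFourier (d := E))),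
      Tendsto (flowMean ω P) atTop (𝓝 (∫ y, P y ∂torusHaar E)) := by
    intro P hP
    induction hP using Submodule.span_induction with
    | mem P hP =>
      obtain ⟨n, rfl⟩ := hP
      by_cases hn : n = 0
      · subst hn
        rw [UnitAddTorus.mFourier_zero]
        simp only [ContinuousMap.one_apply, integral_const, probReal_univ, one_smul]
        refine tendsto_const_nhds.congr' ?_
        filter_upwards [eventually_gt_atTop 0] with T hT
        have : (T : ℂ) ≠ 0 := by exact_mod_cast hT.ne'
        simp [flowMean, this]
      · rw [integral_mFourier_eq_zero hn]
        simp only [flowMean_eq, mFourier_torusFlow]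
        refine tendsto_mean_exp ?_
        have hsum : ∑ e, n e * ω e ≠ 0 := by
          intro h0
          apply hn
          ext e
          have := Fintype.linearIndependent_iff.1 hω (fun e => (n e : ℚ)) (by
            simpa [Rat.smul_def] using h0) e
          simpa using this
        have := Real.pi_ne_zero
        positivity
    | zero => simp [flowMean_eq]
    | add P Q _ _ hP hQ =>
      have h1 : flowMean ω (P + Q) = fun T => flowMean ω P T + flowMean ω Q T := by
        ext T
        simp only [flowMean, ContinuousMap.add_apply]
        rw [intervalIntegral.integral_add
          ((continuous_comp_torusFlow ω P).intervalIntegrable _ _)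
          ((continuous_comp_torusFlow ω Q).intervalIntegrable _ _), mul_add]
      rw [h1]
      simp only [ContinuousMap.add_apply]
      rw [integral_add (hint P) (hint Q)]
      exact hP.add hQ
    | smul c P _ hP =>
      have h1 : flowMean ω (c • P) = fun T => c * flowMean ω P T := by
        ext T
        simp only [flowMean, ContinuousMap.smul_apply, smul_eq_mul,
          intervalIntegral.integral_const_mul]
        ring
      rw [h1]
      simp only [ContinuousMap.smul_apply, smul_eq_mul]
      rw [integral_const_mul]
      exact hP.const_mul c
  rw [Metric.tendsto_nhds]
  intro ε hε
  have hF : F ∈ closure (Submodule.span ℂ (Set.range (UnitAddTorus.mFourier (d := E))) :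
      Set C(UnitAddTorus E, ℂ)) := by
    rw [← Submodule.topologicalClosure_coe, UnitAddTorus.span_mFourier_closure_eq_top]
    trivial
  obtain ⟨P, hP, hFP⟩ := Metric.mem_closure_iff.1 hF (ε / 3) (by positivity)
  have hdist : ∀ y, ‖F y - P y‖ ≤ ε / 3 := fun y => by
    rw [← dist_eq_norm]
    exact (ContinuousMap.dist_apply_le_dist y).trans hFP.le
  filter_upwards [Metric.tendsto_nhds.1 (hspan P hP) (ε / 3) (by positivity),
    eventually_gt_atTop 0] with T hT hT0
  have h1 : dist (flowMean ω F T) (flowMean ω P T) ≤ ε / 3 := by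
    rw [dist_eq_norm, flowMean, flowMean, ← mul_sub, ← intervalIntegral.integral_sub
      ((continuous_comp_torusFlow ω F).intervalIntegrable _ _)
      ((continuous_comp_torusFlow ω P).intervalIntegrable _ _), norm_mul, norm_inv,
      Complex.norm_real, Real.norm_of_nonneg hT0.le]
    have := intervalIntegral.norm_integral_le_of_norm_le_const (a := 0) (b := T)
      (f := fun t => F (torusFlow ω t) - P (torusFlow ω t)) (C := ε / 3) (fun t _ => hdist _)
    rw [sub_zero, abs_of_pos hT0] at this
    calc T⁻¹ * _ ≤ T⁻¹ * (ε / 3 * T) := by gcongr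
      _ = ε / 3 := by field_simp
  have h2 : dist (∫ y, P y ∂torusHaar E) (∫ y, F y ∂torusHaar E) ≤ ε / 3 := by
    rw [dist_comm, dist_eq_norm, ← integral_sub (hint F) (hint P)]
    simpa using norm_integral_le_of_norm_le_const (μ := torusHaar E)
      (Eventually.of_forall hdist)
  calc _ ≤ dist (flowMean ω F T) (flowMean ω P T) + dist (flowMean ω P T) _ +
        dist (∫ y, P y ∂torusHaar E) (∫ y, F y ∂torusHaar E) := dist_triangle4 _ _ _ _
    _ < ε := by linarith

/-- **Kronecker's theorem**: if the frequencies are linearly independent over `ℚ`, the flow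
returns to every non-empty open set of the torus at arbitrarily large times. -/
theorem frequently_torusFlow_mem {ω : E → ℝ} (hω : LinearIndependent ℚ ω) (y : UnitAddTorus E)
    {U : Set (UnitAddTorus E)} (hU : U ∈ 𝓝 y) : ∃ᶠ t in atTop, torusFlow ω t ∈ U := by
  intro hnot
  obtain ⟨K, hK⟩ := eventually_atTop.1 hnot
  obtain ⟨f, hf1, hf0, -, hf⟩ := exists_continuous_one_zero_of_isCompact
    (s := {y}) (t := (interior U)ᶜ) isCompact_singleton isOpen_interior.isClosed_compl
    (by simpa using mem_interior_iff_mem_nhds.2 hU)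
  have hpos : 0 < ∫ y, f y ∂torusHaar E := by
    refine f.continuous.integral_pos_of_hasCompactSupport_nonneg_nonzero
      (HasCompactSupport.of_compactSpace f) (fun y => (hf y).1) (x := y) ?_
    rw [hf1 rfl]; simp
  let F : C(UnitAddTorus E, ℂ) := ⟨fun y => (f y : ℂ), by fun_prop⟩
  have hFint : ∫ y, F y ∂torusHaar E = ((∫ y, f y ∂torusHaar E : ℝ) : ℂ) := integral_ofReal
  have hlim := tendsto_flowMean hω F
  rw [hFint] at hlim
  have hzero : Tendsto (flowMean ω F) atTop (𝓝 0) := by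
    have : Tendsto (fun T : ℝ => (T : ℂ)⁻¹ * ∫ t in (0 : ℝ)..K, F (torusFlow ω t))
        atTop (𝓝 0) := by
      have h := (Complex.continuous_ofReal.tendsto 0).comp tendsto_inv_atTop_zero
      simpa using h.mul_const (∫ t in (0 : ℝ)..K, F (torusFlow ω t))
    refine this.congr' ?_
    filter_upwards [eventually_ge_atTop K] with T hT
    have h0 : ∫ t in K..T, F (torusFlow ω t) = 0 := by
      rw [intervalIntegral.integral_congr (g := fun _ => 0)]
      · simp
      · intro t ht
        rw [Set.uIcc_of_le hT] at ht
        have : torusFlow ω t ∈ (interior U)ᶜ := fun h => hK t ht.1 (interior_subset h)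
        simpa [F] using hf0 this
    rw [flowMean, ← intervalIntegral.integral_add_adjacent_intervals
      ((continuous_comp_torusFlow ω F).intervalIntegrable 0 K)
      ((continuous_comp_torusFlow ω F).intervalIntegrable K T), h0, add_zero]
  have := tendsto_nhds_unique hlim hzero
  exact hpos.ne' (by exact_mod_cast this)

/-- Kronecker's theorem for the points `(exp (i k ω_e))_e` of the product of unit circles. -/
theorem frequently_exp_mem {ω : E → ℝ} (hω : LinearIndependent ℚ ω) {z : E → ℂ}
    (hz : ∀ e, ‖z e‖ = 1) {U : Set (E → ℂ)} (hU : U ∈ 𝓝 z) :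
    ∃ᶠ k : ℝ in atTop, (fun e => Complex.exp ((k * ω e : ℝ) * Complex.I)) ∈ U := by
  choose θ hθ using fun e => (Complex.norm_eq_one_iff (z e)).1 (hz e)
  let y : UnitAddTorus E := fun e => ((θ e / (2 * Real.pi) : ℝ) : UnitAddCircle)
  let Ψ : UnitAddTorus E → E → ℂ := fun y e => fourier 1 (y e)
  have hΨ : Continuous Ψ := by fun_prop
  have hval : ∀ s : ℝ, (fourier 1 ((s / (2 * Real.pi) : ℝ) : UnitAddCircle) : ℂ)
      = Complex.exp (s * Complex.I) := fun s => by
    rw [fourier_coe_apply]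
    congr 1
    have : (Real.pi : ℂ) ≠ 0 := by exact_mod_cast Real.pi_ne_zero
    push_cast
    field_simp
  have hy : Ψ y = z := by
    ext e
    simp only [Ψ, y, hval, hθ]
  have hfreq := frequently_torusFlow_mem hω y (hΨ.continuousAt.preimage_mem_nhds (hy ▸ hU))
  have hpi : 0 < 2 * Real.pi := by positivity
  refine (tendsto_id.const_mul_atTop hpi).frequently (hfreq.mono fun t ht => ?_)
  have hflow : Ψ (torusFlow ω t)
      = fun e => Complex.exp ((2 * Real.pi * id t * ω e : ℝ) * Complex.I) := by
    ext e
    simp only [Ψ, torusFlow, ← hval, id]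
    congr 2
    field_simp
  rw [← hflow]
  exact ht

end Kronecker

/-! ### Two consequences of the maximum principle -/

section MaximumPrinciple

/-- A form of Hurwitz's theorem: a zero of a holomorphic function, all of whose zeros are real,
persists under small perturbations. -/
lemma eventually_exists_zero {X : Type*} [TopologicalSpace X] {F : X → ℂ → ℂ}
    (hF : Continuous (Function.uncurry F)) (hd : ∀ p, Differentiable ℂ (F p)) {p₀ : X}
    (h0 : F p₀ 0 = 0) (hne : ∀ s : ℂ, s.im ≠ 0 → F p₀ s ≠ 0) {ε : ℝ} (hε : 0 < ε) :
    ∀ᶠ p in 𝓝 p₀, ∃ s, ‖s‖ ≤ ε ∧ F p s = 0 := by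
  obtain ⟨r, hr0, hrε, hr⟩ : ∃ r : ℝ, 0 < r ∧ r ≤ ε ∧ ∀ s ∈ Metric.sphere (0 : ℂ) r,
      F p₀ s ≠ 0 := by
    have hev : ∀ᶠ s in 𝓝[≠] (0 : ℂ), F p₀ s ≠ 0 := by
      refine ((hd p₀).analyticAt 0).eventually_eq_zero_or_eventually_ne_zero.resolve_left
        fun hz => ?_
      have hI : Tendsto (fun t : ℝ => (t : ℂ) * Complex.I) (𝓝[>] 0) (𝓝 0) := by
        have : Continuous fun t : ℝ => (t : ℂ) * Complex.I := by fun_prop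
        simpa using (this.tendsto 0).mono_left nhdsWithin_le_nhds
      obtain ⟨t, ht, ht0⟩ := ((hI.eventually hz).and self_mem_nhdsWithin).exists
      exact hne _ (by simpa using (ne_of_gt ht0 : t ≠ 0)) ht
    obtain ⟨δ, hδ, hball⟩ := Metric.eventually_nhds_iff.1 (eventually_nhdsWithin_iff.1 hev)
    refine ⟨min ε (δ / 2), by positivity, min_le_left _ _, fun s hs => ?_⟩
    have hs' : ‖s‖ = min ε (δ / 2) := by simpa using hs
    refine hball ?_ ?_
    · rw [dist_zero_right, hs']
      exact (min_le_right _ _).trans_lt (by linarith)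
    · have : 0 < ‖s‖ := by rw [hs']; positivity
      simpa using this
  have hcp : Continuous (F p₀) := (hd p₀).continuous
  obtain ⟨s₀, hs₀, hmin⟩ := (isCompact_sphere (0 : ℂ) r).exists_isMinOn
    (NormedSpace.sphere_nonempty.2 hr0.le) hcp.norm.continuousOn
  set η := ‖F p₀ s₀‖ with hη
  have hη0 : 0 < η := norm_pos_iff.2 (hr s₀ hs₀)
  have h1 : ∀ᶠ p in 𝓝 p₀, ∀ s ∈ Metric.sphere (0 : ℂ) r, η / 2 < ‖F p s‖ := by
    refine (isCompact_sphere (0 : ℂ) r).eventually_forall_of_forall_eventually fun s hs => ?_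
    have hc : ContinuousAt (fun q : X × ℂ => ‖F q.1 q.2‖) (p₀, s) := hF.norm.continuousAt
    exact hc.eventually_const_lt (by
      have : η ≤ ‖F p₀ s‖ := hmin hs
      linarith)
  have h2 : ∀ᶠ p in 𝓝 p₀, ‖F p 0‖ < η / 2 := by
    have hc : ContinuousAt (fun p : X => ‖F p 0‖) p₀ :=
      (hF.comp (by fun_prop : Continuous fun p : X => (p, (0 : ℂ)))).norm.continuousAt
    exact hc.eventually_lt_const (by simpa [h0] using hη0)
  filter_upwards [h1, h2] with p hp1 hp2
  -- Without zeros, `1 / F p` would be larger at the center of the disc than on its boundary.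
  by_contra! hcon
  have hnz : ∀ s ∈ Metric.closedBall (0 : ℂ) r, F p s ≠ 0 := fun s hs =>
    hcon s ((by simpa using hs : ‖s‖ ≤ r).trans hrε)
  have hdiff : DiffContOnCl ℂ (fun s => (F p s)⁻¹) (Metric.ball 0 r) := by
    refine (hd p).diffContOnCl.inv fun s hs => hnz s ?_
    rwa [closure_ball _ hr0.ne'] at hs
  have hle := Complex.norm_le_of_forall_mem_frontier_norm_le Metric.isBounded_ball hdiff
    (C := (η / 2)⁻¹) (fun s hs => ?_) (z := 0) (subset_closure (Metric.mem_ball_self hr0))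
  · have hpos : 0 < ‖F p 0‖ := norm_pos_iff.2 (hnz 0 (Metric.mem_closedBall_self hr0.le))
    rw [norm_inv, inv_le_inv₀ hpos (by positivity)] at hle
    linarith
  · rw [frontier_ball _ hr0.ne'] at hs
    rw [norm_inv]
    exact inv_anti₀ (by positivity) (hp1 s hs).le

/-- If the kernel of `M 0` is contained in the kernels of all the `M ζ`, it is equal to the kernel
of `M ζ` for some `ζ` on the unit circle. -/
lemma exists_norm_eq_one_ker_eq {n : Type*} [Fintype n] [DecidableEq n] {M : ℂ → Matrix n n ℂ}
    (hM : ∀ i j, Differentiable ℂ fun ζ => M ζ i j)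
    (h0 : ∀ ζ x, (M 0).mulVec x = 0 → (M ζ).mulVec x = 0) :
    ∃ ζ : ℂ, ‖ζ‖ = 1 ∧ ∀ x, (M ζ).mulVec x = 0 → (M 0).mulVec x = 0 := by
  -- `L` is a generalized inverse of `M 0`, so that `1 - L * M 0` projects onto the kernel.
  obtain ⟨L, hL⟩ : ∃ L : Matrix n n ℂ, M 0 * L * M 0 = M 0 := by
    let f := Matrix.toLin' (M 0)
    obtain ⟨C, hC⟩ := Submodule.exists_isCompl (LinearMap.ker f)
    obtain ⟨g, hg⟩ := (f.comp C.subtype).exists_leftInverse_of_injective (by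
      rw [LinearMap.ker_comp, ← Submodule.disjoint_iff_comap_eq_bot]
      exact hC.disjoint.symm)
    refine ⟨LinearMap.toMatrix' (C.subtype.comp g), ?_⟩
    apply Matrix.toLin'.injective
    rw [Matrix.toLin'_mul, Matrix.toLin'_mul, Matrix.toLin'_toMatrix']
    refine LinearMap.ext fun x => ?_
    obtain ⟨a, ha, b, hb, rfl⟩ := Submodule.mem_sup.1
      (hC.sup_eq_top ▸ Submodule.mem_top : x ∈ LinearMap.ker f ⊔ C)
    have ha' : Matrix.toLin' (M 0) a = 0 := ha
    have hb' := LinearMap.congr_fun hg ⟨b, hb⟩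
    simp only [LinearMap.comp_apply, map_add, ha', zero_add, Submodule.subtype_apply,
      LinearMap.id_apply, f] at hb' ⊢
    rw [map_zero, hb', Submodule.coe_zero, map_zero, zero_add]
  let Q : Matrix n n ℂ := 1 - L * M 0
  have hMQ : M 0 * Q = 0 := by
    simp only [Q, mul_sub, mul_one, ← mul_assoc, hL, sub_self]
  -- `L * M ζ + Q` is the identity for `ζ = 0`, hence it is invertible for some `ζ` with `‖ζ‖ = 1`.
  let g : ℂ → ℂ := fun ζ => (L * M ζ + Q).det
  have hg : Differentiable ℂ g := by
    simp only [g, Matrix.det_apply, Matrix.add_apply, Matrix.mul_apply]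
    fun_prop
  have hg0 : g 0 = 1 := by simp [g, Q]
  obtain ⟨ζ, hζ, hgζ⟩ : ∃ ζ : ℂ, ‖ζ‖ = 1 ∧ g ζ ≠ 0 := by
    by_contra! hcon
    have := Complex.norm_le_of_forall_mem_frontier_norm_le (U := Metric.ball (0 : ℂ) 1)
      Metric.isBounded_ball hg.diffContOnCl (C := 0) (fun s hs => ?_) (z := 0)
      (subset_closure (Metric.mem_ball_self one_pos))
    · rw [hg0] at this
      norm_num at this
    · rw [frontier_ball _ one_ne_zero] at hs
      rw [hcon s (by simpa using hs), norm_zero]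
  refine ⟨ζ, hζ, fun x hx => ?_⟩
  -- `x - Q x` lies in the kernels of `M ζ` and of `Q`.
  have hQx : (M 0).mulVec (Q.mulVec x) = 0 := by rw [Matrix.mulVec_mulVec, hMQ, Matrix.zero_mulVec]
  have hQQ : Q.mulVec (Q.mulVec x) = Q.mulVec x := by
    conv_lhs => rw [show Q = 1 - L * M 0 from rfl]
    rw [Matrix.sub_mulVec, Matrix.one_mulVec, ← Matrix.mulVec_mulVec,
      ← show Q = 1 - L * M 0 from rfl, hQx, Matrix.mulVec_zero, sub_zero]
  have hzero : (L * M ζ + Q).mulVec (x - Q.mulVec x) = 0 := by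
    rw [Matrix.add_mulVec, ← Matrix.mulVec_mulVec, Matrix.mulVec_sub (M ζ), hx, h0 ζ _ hQx,
      sub_zero, Matrix.mulVec_zero, Matrix.mulVec_sub, hQQ, sub_self, add_zero]
  have hx0 : x - Q.mulVec x = 0 := by
    by_contra hne
    exact hgζ (Matrix.exists_mulVec_eq_zero_iff.1 ⟨_, hne, hzero⟩)
  rw [sub_eq_zero.1 hx0]
  exact hQx

end MaximumPrinciple

namespace OrientedMultigraph

variable {V E : Type*} (G : OrientedMultigraph V E)

/-! ### Half-edges, amplitudes and vertex conditions -/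

/-- The half-edges of the graph are the pairs `(e, b)`; `(e, false)` is the half of `e` at
`src e`, and `(e, true)` the half at `tgt e`.  This is the vertex at which a half-edge sits. -/
def vert (h : E × Bool) : V := if h.2 then G.tgt h.1 else G.src h.1

/-- The other half of the same edge. -/
def opposite (h : E × Bool) : E × Bool := (h.1, !h.2)

@[simp] lemma opposite_mk (e : E) (b : Bool) : opposite (e, b) = (e, !b) := rfl

@[simp] lemma opposite_fst (h : E × Bool) : (opposite h).1 = h.1 := rfl

@[simp] lemma opposite_opposite (h : E × Bool) : opposite (opposite h) = h := by
  simp [opposite]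

/-- The opposite half-edge, as a permutation. -/
def oppositeEquiv (E : Type*) : Equiv.Perm (E × Bool) :=
  Function.Involutive.toPerm opposite opposite_opposite

lemma oppositeEquiv_apply (h : E × Bool) : oppositeEquiv E h = opposite h := rfl

/-- The set of edges carrying a non-zero amplitude. -/
def edgeSupport (x : E × Bool → ℂ) : Set E := {e | x (e, false) ≠ 0 ∨ x (e, true) ≠ 0}

lemma mem_edgeSupport_of_ne_zero {x : E × Bool → ℂ} {h : E × Bool} (hx : x h ≠ 0) :
    h.1 ∈ edgeSupport x := by
  obtain ⟨e, b | b⟩ := h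
  · exact Or.inl hx
  · exact Or.inr hx

lemma eq_zero_of_notMem_edgeSupport {x : E × Bool → ℂ} {h : E × Bool} (hx : h.1 ∉ edgeSupport x) :
    x h = 0 := by
  by_contra hne
  exact hx (mem_edgeSupport_of_ne_zero hne)

lemma edgeSupport_nonempty {x : E × Bool → ℂ} (hx : x ≠ 0) : (edgeSupport x).Nonempty := by
  obtain ⟨h, hh⟩ := Function.ne_iff.1 hx
  exact ⟨h.1, mem_edgeSupport_of_ne_zero hh⟩

/-- The intensity of a wave on an edge: the sum of the squared moduli of the amplitudes of the two
progressive waves. -/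
noncomputable def intensity (x : E × Bool → ℂ) (e : E) : ℝ≥0 :=
  ‖x (e, false)‖₊ ^ 2 + ‖x (e, true)‖₊ ^ 2

lemma coe_intensity (x : E × Bool → ℂ) (e : E) :
    (intensity x e : ℝ) = ‖x (e, false)‖ ^ 2 + ‖x (e, true)‖ ^ 2 := by
  simp [intensity]

lemma intensity_eq_zero {x : E × Bool → ℂ} {e : E} : intensity x e = 0 ↔ e ∉ edgeSupport x := by
  simp [intensity, edgeSupport]

lemma intensity_smul (a : ℂ) (x : E × Bool → ℂ) (e : E) :
    intensity (a • x) e = ‖a‖₊ ^ 2 * intensity x e := by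
  simp [intensity, nnnorm_mul, mul_pow, mul_add]

lemma continuous_intensity (e : E) : Continuous fun x : E × Bool → ℂ => intensity x e := by
  unfold intensity; fun_prop

section Fintype

variable [Fintype E]

open Classical in
/-- The vertex conditions, in terms of amplitudes.  On the edge `e`, of length `l`, consider the
function which is the sum of two progressive waves of frequency `k`, leaving the half-edges
`h = (e, b)` with amplitudes `x h`.  The wave that arrives at `h` has amplitude
`z e * x (opposite h)` with `z e = exp (i k l)`.  The value of the function at `h` is the sum of the
outgoing and of the incoming amplitude, its outgoing derivative is `i k` times their difference. -/
structure VertexConditions (z : E → ℂ) (x : E × Bool → ℂ) : Prop where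
  continuity : ∃ c : V → ℂ, ∀ h, x h + z h.1 * x (opposite h) = c (G.vert h)
  kirchhoff : ∀ v, ∑ h with G.vert h = v, (x h - z h.1 * x (opposite h)) = 0

variable {G} {z : E → ℂ} {x : E × Bool → ℂ}

lemma VertexConditions.smul (hx : G.VertexConditions z x) (a : ℂ) :
    G.VertexConditions z (a • x) := by
  obtain ⟨⟨c, hc⟩, hk⟩ := hx
  refine ⟨⟨a • c, fun h => ?_⟩, fun v => ?_⟩
  · simp only [Pi.smul_apply, smul_eq_mul, ← hc]; ring
  · rw [← mul_zero a, ← hk v, Finset.mul_sum]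
    refine Finset.sum_congr rfl fun h _ => ?_
    simp only [Pi.smul_apply, smul_eq_mul]; ring

/-- Modifying `z` on edges where the amplitudes vanish does not affect the vertex conditions. -/
lemma VertexConditions.congr (hx : G.VertexConditions z x) {z' : E → ℂ}
    (hz : ∀ e ∈ edgeSupport x, z' e = z e) : G.VertexConditions z' x := by
  have h1 : ∀ h : E × Bool, z' h.1 * x (opposite h) = z h.1 * x (opposite h) := fun h => by
    by_cases he : h.1 ∈ edgeSupport x
    · rw [hz _ he]
    · rw [eq_zero_of_notMem_edgeSupport (h := opposite h) he, mul_zero, mul_zero]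
  exact ⟨by simpa only [h1] using hx.continuity, by simpa only [h1] using hx.kirchhoff⟩

/-- Conservation of the flux: in total, as much intensity arrives at the vertices as leaves
them. -/
lemma VertexConditions.sum_flux [Fintype V] (hx : G.VertexConditions z x) :
    ∑ h : E × Bool, (1 - ‖z h.1‖ ^ 2) * ‖x h‖ ^ 2 = 0 := by
  classical
  obtain ⟨⟨c, hc⟩, hk⟩ := hx
  have h1 : ∑ h : E × Bool, ‖z h.1 * x (opposite h)‖ ^ 2 = ∑ h, ‖z h.1‖ ^ 2 * ‖x h‖ ^ 2 := by
    rw [← Equiv.sum_comp (oppositeEquiv E)]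
    simp [oppositeEquiv_apply, mul_pow]
  have h2 : ∀ u w : ℂ, ‖u‖ ^ 2 - ‖w‖ ^ 2 = ((u - w) * (starRingEnd ℂ) (u + w)).re := fun u w => by
    rw [← Complex.normSq_eq_norm_sq, ← Complex.normSq_eq_norm_sq, Complex.normSq_apply,
      Complex.normSq_apply]
    simp
    ring
  simp only [sub_mul, one_mul, Finset.sum_sub_distrib]
  rw [← h1, ← Finset.sum_sub_distrib]
  simp only [h2, hc]
  rw [← Complex.re_sum, ← Finset.sum_fiberwise _ G.vert]
  have : ∀ v, ∑ h with G.vert h = v, (x h - z h.1 * x (opposite h)) *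
      (starRingEnd ℂ) (c (G.vert h)) = 0 := fun v => by
    rw [← zero_mul ((starRingEnd ℂ) (c v)), ← hk v, Finset.sum_mul]
    refine Finset.sum_congr (by congr) fun h hh => ?_
    rw [(Finset.mem_filter.1 hh).2]
  simp [this]

/-- If the edges absorb, waves vanish on those edges `e` with `‖z e‖ ≠ 1`. In particular there are
no waves whose frequency has positive imaginary part. -/
lemma VertexConditions.eq_zero_of_norm_le_one [Fintype V] (hx : G.VertexConditions z x)
    (hz : ∀ e, ‖z e‖ ≤ 1) {h : E × Bool} (hh : ‖z h.1‖ ≠ 1) : x h = 0 := by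
  have hsq : ∀ e, ‖z e‖ ^ 2 ≤ 1 := fun e => pow_le_one₀ (norm_nonneg _) (hz e)
  have h0 := (Finset.sum_eq_zero_iff_of_nonneg fun h _ =>
    mul_nonneg (sub_nonneg.2 (hsq h.1)) (sq_nonneg ‖x h‖)).1 hx.sum_flux h (Finset.mem_univ h)
  have h1 : 1 - ‖z h.1‖ ^ 2 ≠ 0 := fun h2 => hh
    ((pow_eq_one_iff_of_nonneg (norm_nonneg _) two_ne_zero).1 (by linarith))
  simpa [h1] using h0

/-- If the edges amplify, waves vanish on those edges `e` with `‖z e‖ ≠ 1`. In particular there are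
no waves whose frequency has negative imaginary part. -/
lemma VertexConditions.eq_zero_of_one_le_norm [Fintype V] (hx : G.VertexConditions z x)
    (hz : ∀ e, 1 ≤ ‖z e‖) {h : E × Bool} (hh : ‖z h.1‖ ≠ 1) : x h = 0 := by
  have hsq : ∀ e, 1 ≤ ‖z e‖ ^ 2 := fun e => one_le_pow₀ (hz e)
  have h0 := (Finset.sum_eq_zero_iff_of_nonpos fun h _ =>
    mul_nonpos_of_nonpos_of_nonneg (sub_nonpos.2 (hsq h.1)) (sq_nonneg ‖x h‖)).1 hx.sum_flux h
    (Finset.mem_univ h)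
  have h1 : 1 - ‖z h.1‖ ^ 2 ≠ 0 := fun h2 => hh
    ((pow_eq_one_iff_of_nonneg (norm_nonneg _) two_ne_zero).1 (by linarith))
  simpa [h1] using h0

/-! ### The secular matrix -/

open Classical in
/-- The matrix whose kernel consists of the amplitudes that satisfy the vertex conditions: the
outgoing amplitude at a half-edge is compared with the one which is scattered by the vertex,
namely twice the mean of the incoming amplitudes, minus the incoming amplitude at the same
half-edge. -/
noncomputable def secularMatrix (G : OrientedMultigraph V E) (z : E → ℂ) :
    Matrix (E × Bool) (E × Bool) ℂ := fun h h' =>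
  (if h' = h then 1 else 0) + (if h' = opposite h then z h.1 else 0)
    - (if G.vert (opposite h') = G.vert h then
        2 / ((Finset.univ.filter fun i => G.vert i = G.vert h).card : ℂ) * z h'.1 else 0)

open Classical in
lemma secularMatrix_mulVec (h : E × Bool) :
    (G.secularMatrix z).mulVec x h = x h + z h.1 * x (opposite h)
      - 2 / ((Finset.univ.filter fun i => G.vert i = G.vert h).card : ℂ) *
        ∑ i with G.vert i = G.vert h, z i.1 * x (opposite i) := by
  simp only [Matrix.mulVec, dotProduct, secularMatrix, sub_mul, add_mul, ite_mul, one_mul, zero_mul,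
    Finset.sum_sub_distrib, Finset.sum_add_distrib, Finset.sum_ite_eq', Finset.mem_univ, if_true]
  congr 1
  rw [Finset.mul_sum, Finset.sum_filter, ← Equiv.sum_comp (oppositeEquiv E)]
  simp [oppositeEquiv_apply, mul_assoc]

lemma secularMatrix_mulVec_eq_zero_iff :
    (G.secularMatrix z).mulVec x = 0 ↔ G.VertexConditions z x := by
  classical
  have hcard : ∀ h : E × Bool, ((Finset.univ.filter fun i => G.vert i = G.vert h).card : ℂ) ≠ 0 :=
    fun h => by
      rw [Nat.cast_ne_zero, Finset.card_ne_zero]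
      exact ⟨h, by simp⟩
  constructor
  · intro hx
    have hx' : ∀ h, x h + z h.1 * x (opposite h) =
        2 / ((Finset.univ.filter fun i => G.vert i = G.vert h).card : ℂ) *
        ∑ i with G.vert i = G.vert h, z i.1 * x (opposite i) := fun h => by
      rw [← sub_eq_zero, ← secularMatrix_mulVec, hx, Pi.zero_apply]
    refine ⟨⟨fun v => 2 / ((Finset.univ.filter fun i => G.vert i = v).card : ℂ) *
      ∑ i with G.vert i = v, z i.1 * x (opposite i), hx'⟩, fun v => ?_⟩
    by_cases hv : ∃ h, G.vert h = v
    · obtain ⟨h₀, rfl⟩ := hv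
      have hc := hcard h₀
      have hs : ∀ h ∈ Finset.univ.filter fun i => G.vert i = G.vert h₀,
          x h - z h.1 * x (opposite h) =
          2 / ((Finset.univ.filter fun i => G.vert i = G.vert h₀).card : ℂ) *
          (∑ i with G.vert i = G.vert h₀, z i.1 * x (opposite i))
          - 2 * (z h.1 * x (opposite h)) := fun h hh => by
        have h1 := hx' h
        rw [(Finset.mem_filter.1 hh).2] at h1
        rw [← h1]; ring
      rw [show (∑ h with G.vert h = G.vert h₀, (x h - z h.1 * x (opposite h))) = _ from
        Finset.sum_congr (by congr) hs, Finset.sum_sub_distrib, Finset.sum_const, nsmul_eq_mul,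
        ← Finset.mul_sum]
      field_simp
      ring
    · refine Finset.sum_eq_zero fun h hh => absurd ⟨h, (Finset.mem_filter.1 hh).2⟩ hv
  · rintro ⟨⟨c, hc⟩, hk⟩
    ext h
    rw [secularMatrix_mulVec, Pi.zero_apply, hc h]
    have h1 : ∑ i with G.vert i = G.vert h, (c (G.vert h) - 2 * (z i.1 * x (opposite i))) = 0 := by
      rw [← hk (G.vert h)]
      refine Finset.sum_congr (by congr) fun i hi => ?_
      rw [← (Finset.mem_filter.1 hi).2, ← hc i]; ring
    rw [Finset.sum_sub_distrib, Finset.sum_const, nsmul_eq_mul, ← Finset.mul_sum, sub_eq_zero] at h1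
    rw [div_mul_eq_mul_div, ← h1, mul_div_cancel_left₀ _ (hcard h), sub_self]

lemma det_secularMatrix_eq_zero_iff [DecidableEq E] :
    (G.secularMatrix z).det = 0 ↔ ∃ x, x ≠ 0 ∧ G.VertexConditions z x := by
  rw [← Matrix.exists_mulVec_eq_zero_iff]
  simp only [secularMatrix_mulVec_eq_zero_iff]

end Fintype

end OrientedMultigraph

namespace OrientedMultigraph

variable {V E : Type*} {G : OrientedMultigraph V E}

/-! ### Waves of real frequency close to a given one -/

section Frequencies

/-- The phases `exp (i k l_e)` that waves of frequency `k` acquire along the edges. -/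
noncomputable def phases (l : E → ℝ) (k : ℝ) (e : E) : ℂ := Complex.exp ((k * l e : ℝ) * Complex.I)

lemma norm_phases (l : E → ℝ) (k : ℝ) (e : E) : ‖phases l k e‖ = 1 :=
  Complex.norm_exp_ofReal_mul_I _

variable [Fintype E]

lemma continuous_secularMatrix (G : OrientedMultigraph V E) :
    Continuous fun z => G.secularMatrix z := by
  classical
  refine continuous_matrix fun h h' => ?_
  unfold secularMatrix
  refine ((continuous_const.add ?_).sub ?_)
  · split_ifs <;> fun_prop
  · split_ifs <;> fun_prop

lemma differentiable_secularMatrix_apply (G : OrientedMultigraph V E) {z : ℂ → E → ℂ}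
    (hz : ∀ e, Differentiable ℂ fun s => z s e) (h h' : E × Bool) :
    Differentiable ℂ fun s => G.secularMatrix (z s) h h' := by
  unfold secularMatrix
  refine (((differentiable_const _).add ?_).sub ?_)
  · split_ifs
    · exact hz _
    · fun_prop
  · split_ifs
    · exact (hz _).const_mul _
    · fun_prop

/-- If the lengths are positive and independent over `ℚ`, any phases for which there is a
non-zero wave can be approximated by those of genuine waves, of arbitrarily large frequency. -/
theorem frequently_vertexConditions [Fintype V] {l : E → ℝ} (hpos : ∀ e, 0 < l e)
    (hl : LinearIndependent ℚ l) {z : E → ℂ} (hz : ∀ e, ‖z e‖ = 1) {x : E × Bool → ℂ} (hx0 : x ≠ 0)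
    (hx : G.VertexConditions z x) {U : Set (E → ℂ)} (hU : U ∈ 𝓝 z) :
    ∃ᶠ k : ℝ in atTop, phases l k ∈ U ∧ ∃ y, y ≠ 0 ∧ G.VertexConditions (phases l k) y := by
  classical
  -- `P z s` are the phases after a shift of the frequency by `s`, and `F z s` is the secular
  -- determinant.
  let P : (E → ℂ) → ℂ → E → ℂ := fun z s e => z e * Complex.exp (s * l e * Complex.I)
  let F : (E → ℂ) → ℂ → ℂ := fun z s => (G.secularMatrix (P z s)).det
  have hP : Continuous (Function.uncurry P) := by
    refine continuous_pi fun e => ?_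
    simp only [Function.uncurry_def, P]
    fun_prop
  have hP0 : P z 0 = z := by ext e; simp [P]
  have hF : Continuous (Function.uncurry F) := ((continuous_secularMatrix G).comp hP).matrix_det
  have hFd : ∀ z, Differentiable ℂ (F z) := fun z => by
    have := differentiable_secularMatrix_apply G (z := P z) (fun e => by
      simp only [P]; fun_prop)
    simp only [F, Matrix.det_apply]
    fun_prop
  have hreal : ∀ z : E → ℂ, (∀ e, ‖z e‖ = 1) → ∀ s : ℂ, s.im ≠ 0 → F z s ≠ 0 := by
    intro z hz s hs h0
    obtain ⟨y, hy0, hy⟩ := det_secularMatrix_eq_zero_iff.1 h0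
    have hn : ∀ e, ‖P z s e‖ = Real.exp (-(s.im * l e)) := fun e => by
      simp [P, hz, Complex.norm_exp]
    apply hy0
    ext h
    have hne : ‖P z s h.1‖ ≠ 1 := by
      rw [hn, Ne, Real.exp_eq_one_iff, neg_eq_zero]
      exact mul_ne_zero hs (hpos _).ne'
    rcases lt_or_gt_of_ne hs with h1 | h1
    · refine hy.eq_zero_of_one_le_norm (fun e => ?_) hne
      rw [hn, Real.one_le_exp_iff]
      nlinarith [hpos e]
    · refine hy.eq_zero_of_norm_le_one (fun e => ?_) hne
      rw [hn, Real.exp_le_one_iff]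
      nlinarith [hpos e]
  have hUP : ∀ᶠ q in 𝓝 (z, (0 : ℂ)), P q.1 q.2 ∈ U := by
    refine hP.continuousAt.eventually_mem ?_
    simpa only [Function.uncurry, hP0] using hU
  rw [nhds_prod_eq] at hUP
  obtain ⟨A, hA, B, hB, hAB⟩ := mem_prod_iff.1 hUP
  obtain ⟨δ, hδ, hδB⟩ := Metric.mem_nhds_iff.1 hB
  have hzero := eventually_exists_zero hF hFd (p₀ := z)
    (by simp only [F, hP0]; exact det_secularMatrix_eq_zero_iff.2 ⟨x, hx0, hx⟩)
    (hreal z hz) (ε := min 1 (δ / 2)) (by positivity)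
  rw [frequently_atTop]
  intro K
  obtain ⟨k, hk, ⟨s, hs, hFs⟩, hkA⟩ :=
    frequently_atTop.1 (frequently_exp_mem hl hz (hzero.and hA)) (K + 1)
  -- At the frequency `k` the phases are so close to `z` that `F` has a zero `s`; it is real, and so
  -- `k + s` is the frequency of a genuine wave.
  have him : s.im = 0 := by
    by_contra hs'
    exact hreal _ (norm_phases l k) s hs' hFs
  have hPs : P (phases l k) s = phases l (k + s.re) := by
    ext e
    have : (s.re : ℂ) = s := Complex.ext rfl (by simp [him])
    simp only [P, phases, ← Complex.exp_add]
    congr 1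
    push_cast
    rw [this]
    ring
  have hsre : |s.re| ≤ min 1 (δ / 2) := (Complex.abs_re_le_norm s).trans hs
  refine ⟨k + s.re, ?_, ?_, ?_⟩
  · have := (abs_le.1 (hsre.trans (min_le_left _ _))).1
    linarith
  · rw [← hPs]
    refine hAB (Set.mk_mem_prod hkA (hδB ?_))
    rw [mem_ball_zero_iff]
    exact (hs.trans (min_le_right _ _)).trans_lt (by linarith)
  · rw [← hPs]
    exact det_secularMatrix_eq_zero_iff.1 hFs

/-- The phases of the edges outside a set `S` can be chosen in such a way that all the waves are
supported in `S`.  Indeed this is the case for the value `0` of these phases, where waves are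
absorbed outside `S`. -/
theorem exists_phases_edgeSupport_subset [Fintype V] (G : OrientedMultigraph V E) (S : Set E)
    {z : E → ℂ} (hz : ∀ e, ‖z e‖ = 1) :
    ∃ z' : E → ℂ, (∀ e, ‖z' e‖ = 1) ∧ (∀ e ∈ S, z' e = z e) ∧
      ∀ x, G.VertexConditions z' x → edgeSupport x ⊆ S := by
  classical
  let Z : ℂ → E → ℂ := fun ζ e => if e ∈ S then z e else ζ
  have hsupp : ∀ x, G.VertexConditions (Z 0) x → edgeSupport x ⊆ S := by
    intro x hx e he
    by_contra heS
    have h0 : ∀ b, x (e, b) = 0 := fun b => by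
      refine hx.eq_zero_of_norm_le_one (fun e => ?_) ?_
      · simp only [Z]; split_ifs <;> simp [hz]
      · simp [Z, heS]
    rcases he with h | h <;> exact h (h0 _)
  obtain ⟨ζ, hζ, hker⟩ := exists_norm_eq_one_ker_eq (M := fun ζ => G.secularMatrix (Z ζ))
    (fun h h' => differentiable_secularMatrix_apply G (fun e => by
      simp only [Z]; split_ifs <;> fun_prop) h h')
    (fun ζ x hx => by
      rw [secularMatrix_mulVec_eq_zero_iff] at hx ⊢
      refine hx.congr fun e he => ?_
      simp [Z, hsupp x hx he])
  refine ⟨Z ζ, fun e => ?_, fun e he => by simp [Z, he], fun x hx => hsupp x ?_⟩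
  · simp only [Z]; split_ifs <;> simp [hz, hζ]
  · simp only [secularMatrix_mulVec_eq_zero_iff] at hker
    exact hker x hx

end Frequencies

/-! ### Supports of waves -/

section Supports

lemma intensity_eq_half (x : E × Bool → ℂ) (h : E × Bool) :
    (intensity x h.1 : ℝ) = ‖x h‖ ^ 2 + ‖x (opposite h)‖ ^ 2 := by
  obtain ⟨e, b | b⟩ := h <;> simp [coe_intensity, add_comm]

variable [Fintype E] {z : E → ℂ} {x : E × Bool → ℂ}

/-- Two edges which are adjacent at a vertex have the same intensity, if there is no wave on
the other edges at this vertex. -/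
lemma VertexConditions.intensity_eq (hx : G.VertexConditions z x) (hz : ∀ e, ‖z e‖ = 1)
    {h₁ h₂ : E × Bool} (hne : h₁ ≠ h₂) (hv : G.vert h₁ = G.vert h₂)
    (hother : ∀ h, G.vert h = G.vert h₁ → h ≠ h₁ → h ≠ h₂ → h.1 ∉ edgeSupport x) :
    intensity x h₁.1 = intensity x h₂.1 := by
  classical
  obtain ⟨⟨c, hc⟩, hk⟩ := hx
  have h1 : x h₁ + z h₁.1 * x (opposite h₁) = x h₂ + z h₂.1 * x (opposite h₂) := by
    rw [hc, hc, hv]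
  have h2 : (x h₁ - z h₁.1 * x (opposite h₁)) + (x h₂ - z h₂.1 * x (opposite h₂)) = 0 := by
    rw [← hk (G.vert h₁), ← Finset.sum_pair hne
      (f := fun h => x h - z h.1 * x (opposite h))]
    refine Finset.sum_subset_zero_on_sdiff ?_ (fun h hh => ?_) fun _ _ => rfl
    · intro h hh
      rcases Finset.mem_insert.1 hh with rfl | hh
      · simp
      · rw [Finset.mem_singleton.1 hh]; simp [hv]
    · simp only [Finset.mem_sdiff, Finset.mem_filter, Finset.mem_univ, true_and,
        Finset.mem_insert, Finset.mem_singleton, not_or] at hh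
      have hns := hother h hh.1 hh.2.1 hh.2.2
      rw [eq_zero_of_notMem_edgeSupport hns,
        eq_zero_of_notMem_edgeSupport (h := opposite h) hns]
      simp
  have h3 : x h₁ = z h₂.1 * x (opposite h₂) := by linear_combination (h1 + h2) / 2
  have h4 : x h₂ = z h₁.1 * x (opposite h₁) := by linear_combination (h2 - h1) / 2
  have h5 : ‖x h₁‖ = ‖x (opposite h₂)‖ := by rw [h3, norm_mul, hz, one_mul]
  have h6 : ‖x h₂‖ = ‖x (opposite h₁)‖ := by rw [h4, norm_mul, hz, one_mul]
  rw [← NNReal.coe_inj, intensity_eq_half, intensity_eq_half, h5, h6, add_comm]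

lemma degree_eq_card (G : OrientedMultigraph V E) (v : V) :
    G.degree v = Nat.card {h : E × Bool // G.vert h = v} := by
  have e : {h : E × Bool // G.vert h = v} ≃ {e // G.src e = v} ⊕ {e // G.tgt e = v} :=
    { toFun := fun h => match h with
        | ⟨(e, false), he⟩ => Sum.inl ⟨e, he⟩
        | ⟨(e, true), he⟩ => Sum.inr ⟨e, he⟩
      invFun := Sum.elim (fun e => ⟨(e.1, false), e.2⟩) (fun e => ⟨(e.1, true), e.2⟩)
      left_inv := by rintro ⟨⟨e, b | b⟩, he⟩ <;> rfl
      right_inv := by rintro (e | e) <;> rfl }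
  rw [Nat.card_congr e, Nat.card_sum, degree]

lemma eq_of_degree_eq_one {v : V} (hv : G.degree v = 1) {h h' : E × Bool} (hh : G.vert h = v)
    (hh' : G.vert h' = v) : h = h' := by
  rw [degree_eq_card, Nat.card_eq_one_iff_unique] at hv
  have := hv.1
  exact congrArg Subtype.val (Subsingleton.elim (⟨h, hh⟩ : {h // G.vert h = v}) ⟨h', hh'⟩)

lemma exists_ne_of_degree_ne_one {h : E × Bool} (hv : G.degree (G.vert h) ≠ 1) :
    ∃ h', h' ≠ h ∧ G.vert h' = G.vert h := by
  by_contra! hcon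
  refine hv ?_
  rw [degree_eq_card, Nat.card_eq_one_iff_unique]
  refine ⟨⟨fun a b => ?_⟩, ⟨⟨h, rfl⟩⟩⟩
  have hu : ∀ a : {i // G.vert i = G.vert h}, a = ⟨h, rfl⟩ := fun a => by
    by_contra hne
    exact hcon a.1 (fun h1 => hne (Subtype.ext h1)) a.2
  rw [hu a, hu b]

/-- The support of a wave has no end points, except at vertices of degree `1`: a wave on a
single edge at some other vertex would have value and derivative zero there. -/
lemma VertexConditions.exists_ne_mem_edgeSupport (hx : G.VertexConditions z x)
    (hz : ∀ e, ‖z e‖ = 1) {h : E × Bool} (hh : h.1 ∈ edgeSupport x)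
    (hdeg : G.degree (G.vert h) ≠ 1) :
    ∃ h', h' ≠ h ∧ G.vert h' = G.vert h ∧ h'.1 ∈ edgeSupport x := by
  classical
  obtain ⟨h', hne, hv⟩ := exists_ne_of_degree_ne_one hdeg
  by_contra! hcon
  have hzero : ∀ i, i ≠ h → G.vert i = G.vert h → x i = 0 ∧ x (opposite i) = 0 := fun i hi hiv =>
    ⟨eq_zero_of_notMem_edgeSupport (hcon i hi hiv),
      eq_zero_of_notMem_edgeSupport (h := opposite i) (hcon i hi hiv)⟩
  obtain ⟨⟨c, hc⟩, hk⟩ := hx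
  have h1 : x h + z h.1 * x (opposite h) = 0 := by
    rw [hc, ← hv, ← hc, (hzero h' hne hv).1, (hzero h' hne hv).2, mul_zero, add_zero]
  have h2 : x h - z h.1 * x (opposite h) = 0 := by
    rw [← hk (G.vert h)]
    refine (Finset.sum_eq_single_of_mem (f := fun h => x h - z h.1 * x (opposite h)) h (by simp)
      fun i hi hih => ?_).symm
    have hiv := (Finset.mem_filter.1 hi).2
    rw [(hzero i hih hiv).1, (hzero i hih hiv).2, mul_zero, sub_zero]
  have h3 : x h = 0 := by linear_combination (h1 + h2) / 2
  have h4 : x (opposite h) = 0 := by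
    have h5 : z h.1 * x (opposite h) = 0 := by linear_combination (h1 - h2) / 2
    have h6 : z h.1 ≠ 0 := by rw [← norm_ne_zero_iff, hz]; norm_num
    exact (mul_eq_zero.1 h5).resolve_left h6
  have h7 := intensity_eq_half x h
  rw [h3, h4, norm_zero] at h7
  refine intensity_eq_zero.1 ?_ hh
  rw [← NNReal.coe_eq_zero, h7]
  norm_num

end Supports

end OrientedMultigraph

namespace OrientedMultigraph

variable {V E : Type*} {G : OrientedMultigraph V E}

/-! ### Waves along simple cycles and simple paths between leaves -/

/-- A common description of simple cycles and of simple paths between vertices of degree `1`: the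
edge set `γ` is traversed by `n + 1` consecutive half-edges `a 0, …, a n`, which belong to distinct
edges; the inner vertices are visited only once; and either the first vertex is equal to the last
one, or both have degree `1`. -/
structure IsChain (G : OrientedMultigraph V E) (γ : Finset E) (n : ℕ) (a : ℕ → E × Bool) :
    Prop where
  vert_succ : ∀ i ≤ n, G.vert (opposite (a i)) = G.vert (a (i + 1))
  edge_inj : ∀ i ≤ n, ∀ j ≤ n, (a i).1 = (a j).1 → i = j
  vert_inj : ∀ i, 1 ≤ i → i ≤ n → ∀ j ≤ n + 1, G.vert (a j) = G.vert (a i) → j = i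
  ends : G.vert (a 0) = G.vert (a (n + 1)) ∨
    (G.degree (G.vert (a 0)) = 1 ∧ G.degree (G.vert (a (n + 1))) = 1)
  mem_iff : ∀ e, e ∈ γ ↔ ∃ i ≤ n, (a i).1 = e

lemma Joins.exists_half {e : E} {u w : V} (h : G.Joins e u w) :
    ∃ b, G.vert (e, b) = u ∧ G.vert (e, !b) = w := by
  rcases h with ⟨h1, h2⟩ | ⟨h1, h2⟩
  · exact ⟨false, h1, h2⟩
  · exact ⟨true, h2, h1⟩

lemma joins_vert (h : E × Bool) : G.Joins h.1 (G.vert h) (G.vert (opposite h)) := by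
  obtain ⟨e, b | b⟩ := h
  · exact Or.inl ⟨rfl, rfl⟩
  · exact Or.inr ⟨rfl, rfl⟩

lemma IsSimpleCycle.exists_isChain {γ : Finset E} (h : G.IsSimpleCycle γ) :
    ∃ n a, G.IsChain γ n a := by
  obtain ⟨n, v, e, hv, he, hj, hγ⟩ := h
  choose b hb1 hb2 using fun i => (hj i).exists_half
  have hval : ∀ i ≤ n, (Fin.ofNat (n + 1) i : ℕ) = i := fun i hi =>
    Nat.mod_eq_of_lt (Nat.lt_succ_of_le hi)
  refine ⟨n, fun i => (e (Fin.ofNat (n + 1) i), b (Fin.ofNat (n + 1) i)), ?_, ?_, ?_, ?_, ?_⟩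
  · intro i _
    simp only [opposite_mk, hb2, hb1]
    congr 1
    ext
    simp [Fin.val_add]
  · intro i hi j hj h
    have := congrArg Fin.val (he h)
    rwa [hval i hi, hval j hj] at this
  · intro i hi1 hi j hj h
    simp only [hb1] at h
    have := congrArg Fin.val (hv h)
    rw [hval i hi] at this
    rcases Nat.lt_or_ge n j with hnj | hnj
    · obtain rfl : j = n + 1 := by omega
      simp at this
      omega
    · rwa [hval j hnj] at this
  · left
    simp only [hb1]
    congr 1
    simp
  · intro f
    rw [← Finset.mem_coe, hγ]
    constructor
    · rintro ⟨i, rfl⟩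
      exact ⟨i, by omega, congrArg e (Fin.ext (hval i (by omega)))⟩
    · rintro ⟨i, _, rfl⟩
      exact ⟨_, rfl⟩

lemma IsSimpleLeafPath.exists_isChain {γ : Finset E} (h : G.IsSimpleLeafPath γ) :
    ∃ n a, G.IsChain γ n a := by
  obtain ⟨n, v, e, hv, hj, hd0, hd1, hγ⟩ := h
  choose b hb1 hb2 using fun i => (hj i).exists_half
  -- The half-edge at the last vertex is only needed to give this vertex a name.
  let a : ℕ → E × Bool := fun i => if i ≤ n then (e (Fin.ofNat (n + 1) i), b (Fin.ofNat (n + 1) i))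
    else (e (Fin.last n), !b (Fin.last n))
  have hval : ∀ i ≤ n, (Fin.ofNat (n + 1) i : ℕ) = i := fun i hi =>
    Nat.mod_eq_of_lt (Nat.lt_succ_of_le hi)
  have ha : ∀ i (hi : i ≤ n + 1), G.vert (a i) = v ⟨i, by omega⟩ := by
    intro i hi
    by_cases hin : i ≤ n
    · simp only [a, hin, if_true, hb1]
      congr 1
      ext
      simpa using hin
    · obtain rfl : i = n + 1 := by omega
      simp only [a, hin, if_false, hb2]
      congr 1
  have ha' : ∀ i (hi : i ≤ n), G.vert (opposite (a i)) = v ⟨i + 1, by omega⟩ := by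
    intro i hi
    simp only [a, hi, if_true, opposite_mk, hb2]
    congr 1
    ext
    simpa using hi
  refine ⟨n, a, ?_, ?_, ?_, ?_, ?_⟩
  · intro i hi
    rw [ha i.succ (by omega), ha' i hi]
  · intro i hi j hj h
    rcases eq_or_ne (a i) (a j) with hij | hij
    · have := congrArg G.vert hij
      rw [ha i (by omega), ha j (by omega)] at this
      simpa using hv this
    · have hop : a j = opposite (a i) := by
        refine Prod.ext h.symm ?_
        have : (a i).2 ≠ (a j).2 := fun h2 => hij (Prod.ext h h2)
        exact (Bool.eq_not.2 this.symm)
      have h1 := congrArg G.vert hop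
      rw [ha j (by omega), ha' i hi] at h1
      have h2 := congrArg G.vert (congrArg opposite hop)
      rw [opposite_opposite, ha i (by omega), ha' j hj] at h2
      have h3 := congrArg Fin.val (hv h1)
      have h4 := congrArg Fin.val (hv h2)
      simp only at h3 h4
      omega
  · intro i hi1 hi j hj h
    rw [ha i (by omega), ha j (by omega)] at h
    simpa using hv h
  · right
    rw [ha 0 (by omega), ha (n + 1) le_rfl]
    exact ⟨hd0, hd1⟩
  · intro f
    rw [← Finset.mem_coe, hγ]
    constructor
    · rintro ⟨i, rfl⟩
      have hi : (i : ℕ) ≤ n := by omega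
      refine ⟨i, hi, ?_⟩
      simp only [a, hi, if_true]
      exact congrArg e (Fin.ext (hval i hi))
    · rintro ⟨i, hi, rfl⟩
      exact ⟨Fin.ofNat (n + 1) i, by simp only [a, hi, if_true]⟩

namespace IsChain

variable {γ : Finset E} {n : ℕ} {a : ℕ → E × Bool}

lemma mem_edge (h : G.IsChain γ n a) {i : ℕ} (hi : i ≤ n) : (a i).1 ∈ γ :=
  (h.mem_iff _).2 ⟨i, hi, rfl⟩

lemma exists_index (h : G.IsChain γ n a) {i : E × Bool} (hi : i.1 ∈ γ) :
    ∃ j ≤ n, i = a j ∨ i = opposite (a j) := by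
  obtain ⟨j, hj, he⟩ := (h.mem_iff _).1 hi
  refine ⟨j, hj, ?_⟩
  by_cases h2 : i.2 = (a j).2
  · exact Or.inl (Prod.ext he.symm h2)
  · exact Or.inr (Prod.ext he.symm (Bool.eq_not.2 h2))

lemma ne_opposite (h : G.IsChain γ n a) {i j : ℕ} (hi : i ≤ n) (hj : j ≤ n) :
    a i ≠ opposite (a j) := by
  intro he
  obtain rfl := h.edge_inj i hi j hj (by rw [he, opposite_fst])
  have := congrArg Prod.snd he
  simp [opposite] at this

/-- The function on half-edges with values `f i` at `a i` and `g i` at `opposite (a i)`, and zero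
at the half-edges that are not in the chain. -/
noncomputable def spread (_ : G.IsChain γ n a) (f g : ℕ → ℂ) (h : E × Bool) : ℂ := by
  classical exact ∑ i ∈ Finset.range (n + 1),
    ((if h = a i then f i else 0) + (if h = opposite (a i) then g i else 0))

lemma spread_apply (h : G.IsChain γ n a) (f g : ℕ → ℂ) {j : ℕ} (hj : j ≤ n) :
    h.spread f g (a j) = f j := by
  rw [spread, Finset.sum_eq_single_of_mem j (Finset.mem_range.2 (by omega))]
  · rw [if_pos rfl, if_neg (h.ne_opposite hj hj), add_zero]
  · intro i hi hij
    rw [Finset.mem_range] at hi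
    rw [if_neg, if_neg (h.ne_opposite hj (by omega)), add_zero]
    exact fun he => hij (h.edge_inj j hj i (by omega) (congrArg Prod.fst he)).symm

lemma spread_apply_opposite (h : G.IsChain γ n a) (f g : ℕ → ℂ) {j : ℕ} (hj : j ≤ n) :
    h.spread f g (opposite (a j)) = g j := by
  rw [spread, Finset.sum_eq_single_of_mem j (Finset.mem_range.2 (by omega))]
  · rw [if_neg (h.ne_opposite hj hj).symm, if_pos rfl, zero_add]
  · intro i hi hij
    rw [Finset.mem_range] at hi
    rw [if_neg (h.ne_opposite (by omega) hj).symm, if_neg, add_zero]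
    exact fun he => hij (h.edge_inj j hj i (by omega)
      (by rw [← opposite_fst (a j), he, opposite_fst])).symm

lemma spread_apply_of_notMem (h : G.IsChain γ n a) (f g : ℕ → ℂ) {i : E × Bool} (hi : i.1 ∉ γ) :
    h.spread f g i = 0 := by
  refine Finset.sum_eq_zero fun j hj => ?_
  rw [Finset.mem_range] at hj
  rw [if_neg, if_neg, add_zero]
  · rintro rfl
    exact hi (h.mem_edge (by omega))
  · rintro rfl
    exact hi (h.mem_edge (by omega))

open Classical in
lemma sum_spread [Fintype E] (h : G.IsChain γ n a) (f g : ℕ → ℂ) (v : V) :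
    ∑ i with G.vert i = v, h.spread f g i = ∑ j ∈ Finset.range (n + 1),
      ((if G.vert (a j) = v then f j else 0) + (if G.vert (a (j + 1)) = v then g j else 0)) := by
  simp only [spread]
  rw [Finset.sum_comm]
  refine Finset.sum_congr rfl fun j hj => ?_
  rw [Finset.sum_add_distrib, Finset.sum_ite_eq', Finset.sum_ite_eq']
  rw [Finset.mem_range] at hj
  simp [h.vert_succ j (by omega)]

/-- There is a non-zero wave which is supported in the chain, for suitable phases. It is a cosine
along the chain. In the proof `w i` is the exponential of `i` times its phase at the `i`-th vertex:
`w i = 1` at ends of degree `1`, where the derivative of the wave vanishes, and `w i = I` at the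
other vertices, where the wave vanishes, so that it can be extended by zero to the other edges. -/
lemma exists_vertexConditions [Fintype E] (h : G.IsChain γ n a) :
    ∃ (z : E → ℂ) (x : E × Bool → ℂ), (∀ e, ‖z e‖ = 1) ∧ x ≠ 0 ∧ G.VertexConditions z x ∧
      edgeSupport x ⊆ γ := by
  classical
  obtain ⟨w, hw, hval, hend⟩ : ∃ w : ℕ → ℂ, (∀ i, w i * (starRingEnd ℂ) (w i) = 1) ∧
      (∀ i ≤ n + 1, w i + (starRingEnd ℂ) (w i) = 0 ∨
        (w i + (starRingEnd ℂ) (w i) = 2 ∧ G.degree (G.vert (a i)) = 1)) ∧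
      ((w 0 = w (n + 1) ∧ G.vert (a 0) = G.vert (a (n + 1))) ∨
        (w 0 - (starRingEnd ℂ) (w 0) = 0 ∧ w (n + 1) - (starRingEnd ℂ) (w (n + 1)) = 0)) := by
    rcases h.ends with he | ⟨he1, he2⟩
    · exact ⟨fun _ => Complex.I, by simp, by simp, Or.inl ⟨rfl, he⟩⟩
    · refine ⟨fun i => if i = 0 ∨ i = n + 1 then 1 else Complex.I, fun i => ?_, fun i _ => ?_,
        Or.inr (by simp)⟩
      · dsimp only; split_ifs <;> simp
      · dsimp only; split_ifs with hi
        · right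
          refine ⟨by norm_num, ?_⟩
          rcases hi with rfl | rfl <;> assumption
        · left; simp
  have hw1 : ∀ i, ‖w i‖ = 1 := fun i => by
    have := congrArg norm (hw i)
    rw [norm_mul, Complex.norm_conj, norm_one] at this
    nlinarith [norm_nonneg (w i)]
  let z : E → ℂ := fun e => if he : ∃ i ≤ n, (a i).1 = e then
    w (he.choose + 1) * (starRingEnd ℂ) (w he.choose) else 1
  have hz : ∀ i ≤ n, z (a i).1 = w (i + 1) * (starRingEnd ℂ) (w i) := by
    intro i hi
    have he : ∃ j ≤ n, (a j).1 = (a i).1 := ⟨i, hi, rfl⟩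
    have hc : he.choose = i := h.edge_inj _ he.choose_spec.1 _ hi he.choose_spec.2
    simp only [z, dif_pos he, hc]
  let x := h.spread w fun i => (starRingEnd ℂ) (w (i + 1))
  have hin : ∀ i, z i.1 * x (opposite i) =
      h.spread (fun i => (starRingEnd ℂ) (w i)) (fun i => w (i + 1)) i := by
    intro i
    by_cases hi : i.1 ∈ γ
    · obtain ⟨j, hj, rfl | rfl⟩ := h.exists_index hi
      · simp only [x, h.spread_apply_opposite _ _ hj, h.spread_apply _ _ hj, hz j hj]
        linear_combination (starRingEnd ℂ) (w j) * hw (j + 1)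
      · simp only [x, h.spread_apply_opposite _ _ hj, opposite_opposite, opposite_fst,
          h.spread_apply _ _ hj, hz j hj]
        linear_combination w (j + 1) * hw j
    · simp only [x]
      rw [h.spread_apply_of_notMem _ _ hi, h.spread_apply_of_notMem (i := opposite i) _ _ hi,
        mul_zero]
  refine ⟨z, x, fun e => ?_, fun hx => ?_, ⟨⟨fun v => if ∃ i ≤ n + 1, G.vert (a i) = v ∧
      w i + (starRingEnd ℂ) (w i) = 2 then 2 else 0, fun i => ?_⟩, fun v => ?_⟩, fun e he => ?_⟩
  · by_cases he : ∃ i ≤ n, (a i).1 = e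
    · obtain ⟨i, hi, rfl⟩ := he
      rw [hz i hi, norm_mul, Complex.norm_conj, hw1, hw1, mul_one]
    · simp [z, he]
  · have h0 := congrFun hx (a 0)
    simp only [x, h.spread_apply _ _ (Nat.zero_le n), Pi.zero_apply] at h0
    have := hw1 0
    rw [h0, norm_zero] at this
    exact zero_ne_one this
  · rw [hin]
    -- the value of the wave at the half-edges of the chain which sit at the vertex number `j`
    have hkey : ∀ i : E × Bool, ∀ j ≤ n + 1, G.vert (a j) = G.vert i →
        w j + (starRingEnd ℂ) (w j) = if ∃ k ≤ n + 1, G.vert (a k) = G.vert i ∧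
          w k + (starRingEnd ℂ) (w k) = 2 then 2 else 0 := by
      intro i j hj hji
      rcases hval j hj with h0 | ⟨h2, hd⟩
      · rw [h0, if_neg]
        rintro ⟨k, hk, hki, hk2⟩
        rcases hval k hk with h0' | ⟨-, hd⟩
        · rw [h0'] at hk2; norm_num at hk2
        -- the vertex has degree one, so that it is visited at one end of the chain only
        have hcase : ∀ j k, j ≤ n + 1 → k ≤ n + 1 → G.vert (a j) = G.vert (a k) →
            G.degree (G.vert (a k)) = 1 → j < k → False := by
          intro j k hj hk hjk hd hlt
          obtain ⟨m, rfl⟩ : ∃ m, k = m + 1 := ⟨k - 1, by omega⟩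
          refine h.ne_opposite (i := j) (j := m) (by omega) (by omega)
            (eq_of_degree_eq_one hd hjk (h.vert_succ m (by omega)))
        rcases lt_trichotomy j k with hlt | rfl | hlt
        · exact hcase j k hj hk (hji.trans hki.symm) hd hlt
        · rw [h0] at hk2; norm_num at hk2
        · exact hcase k j hk hj (hki.trans hji.symm) (by rw [hji, ← hki]; exact hd) hlt
      · rw [h2, if_pos ⟨j, hj, hji, h2⟩]
    by_cases hi : i.1 ∈ γ
    · obtain ⟨j, hj, rfl | rfl⟩ := h.exists_index hi
      · simp only [x, h.spread_apply _ _ hj]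
        exact hkey (a j) j (by omega) rfl
      · simp only [x, h.spread_apply_opposite _ _ hj]
        rw [add_comm]
        exact hkey (opposite (a j)) (j + 1) (by omega) (h.vert_succ j hj).symm
    · simp only [x, h.spread_apply_of_notMem _ _ hi, add_zero]
      rw [if_neg]
      rintro ⟨j, hj, hji, hj2⟩
      rcases hval j hj with h0 | ⟨-, hd⟩
      · rw [h0] at hj2; norm_num at hj2
      · rcases Nat.lt_or_ge n j with hnj | hnj
        · obtain rfl : j = n + 1 := by omega
          refine hi ?_
          rw [← eq_of_degree_eq_one hd (h.vert_succ n le_rfl) hji.symm]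
          exact h.mem_edge le_rfl
        · refine hi ?_
          rw [← eq_of_degree_eq_one hd rfl hji.symm]
          exact h.mem_edge hnj
  · simp only [hin]
    rw [Finset.sum_sub_distrib]
    simp only [x]
    rw [show ∀ f g, ∑ i with G.vert i = v, h.spread f g i = _ from fun f g => h.sum_spread f g v,
      show ∀ f g, ∑ i with G.vert i = v, h.spread f g i = _ from fun f g => h.sum_spread f g v,
      ← Finset.sum_sub_distrib]
    have htel : ∀ j ∈ Finset.range (n + 1),
        ((if G.vert (a j) = v then w j else 0) +
          (if G.vert (a (j + 1)) = v then (starRingEnd ℂ) (w (j + 1)) else 0)) -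
        ((if G.vert (a j) = v then (starRingEnd ℂ) (w j) else 0) +
          (if G.vert (a (j + 1)) = v then w (j + 1) else 0)) =
        (if G.vert (a j) = v then w j - (starRingEnd ℂ) (w j) else 0) -
        (if G.vert (a (j + 1)) = v then w (j + 1) - (starRingEnd ℂ) (w (j + 1)) else 0) := by
      intro j _
      split_ifs <;> ring
    rw [Finset.sum_congr rfl htel, Finset.sum_range_sub'
      (fun j => if G.vert (a j) = v then w j - (starRingEnd ℂ) (w j) else 0)]
    rcases hend with ⟨h1, h2⟩ | ⟨h1, h2⟩
    · rw [h1, h2, sub_self]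
    · rw [h1, h2]; simp
  · by_contra hne
    rcases he with he | he
    · exact he (h.spread_apply_of_notMem (i := (e, false)) _ _ hne)
    · exact he (h.spread_apply_of_notMem (i := (e, true)) _ _ hne)

/-- A wave which is supported in a chain has the same intensity on all of its edges. -/
lemma intensity_eq [Fintype E] (h : G.IsChain γ n a) {z : E → ℂ} {x : E × Bool → ℂ}
    (hx : G.VertexConditions z x) (hz : ∀ e, ‖z e‖ = 1) (hγ : edgeSupport x ⊆ γ) {e : E}
    (he : e ∈ γ) : intensity x e = intensity x (a 0).1 := by
  obtain ⟨i, hi, rfl⟩ := (h.mem_iff e).1 he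
  clear he
  induction i with
  | zero => rfl
  | succ i ih =>
    rw [← ih (by omega)]
    have hv := h.vert_succ i (by omega)
    refine (hx.intensity_eq hz (h₁ := a (i + 1)) (h₂ := opposite (a i))
      (h.ne_opposite hi (by omega)) hv.symm fun j hj h1 h2 hjs => ?_).trans rfl
    obtain ⟨k, hk, rfl | rfl⟩ := h.exists_index (hγ hjs)
    · obtain rfl := h.vert_inj (i + 1) (by omega) hi k (by omega) hj
      exact h1 rfl
    · rw [h.vert_succ k hk] at hj
      have := h.vert_inj (i + 1) (by omega) hi (k + 1) (by omega) hj
      obtain rfl : k = i := by omega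
      exact h2 rfl

/-- A non-zero wave which is supported in a chain has a constant positive intensity on the edges
of the chain, and intensity zero on the other ones. -/
lemma exists_intensity_eq [Fintype E] (h : G.IsChain γ n a) {z : E → ℂ} {x : E × Bool → ℂ}
    (hx : G.VertexConditions z x) (hz : ∀ e, ‖z e‖ = 1) (hx0 : x ≠ 0) (hγ : edgeSupport x ⊆ γ) :
    ∃ m : ℝ≥0, m ≠ 0 ∧ (∀ e ∈ γ, intensity x e = m) ∧ ∀ e ∉ γ, intensity x e = 0 := by
  refine ⟨intensity x (a 0).1, ?_, fun e he => h.intensity_eq hx hz hγ he,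
    fun e he => intensity_eq_zero.2 fun h' => he (hγ h')⟩
  obtain ⟨e, he⟩ := edgeSupport_nonempty hx0
  rw [← h.intensity_eq hx hz hγ (hγ he), Ne, intensity_eq_zero, not_not]
  exact he

end IsChain

/-! ### Finding a simple cycle or a simple path between leaves -/

/-- A non-empty set of edges without dead ends, except at vertices of degree `1`, contains a simple
cycle or a simple path between two vertices of degree `1`. -/
theorem exists_cycle_or_leafPath_subset [Finite V] [Fintype E] {S : Set E} (hS : S.Nonempty)
    (hend : ∀ h : E × Bool, h.1 ∈ S → G.degree (G.vert h) ≠ 1 →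
      ∃ h', h' ≠ h ∧ G.vert h' = G.vert h ∧ h'.1 ∈ S) :
    ∃ γ : Finset E, (G.IsSimpleCycle γ ∨ G.IsSimpleLeafPath γ) ∧ (γ : Set E) ⊆ S := by
  classical
  -- The walk starts at a leaf, if there is one.
  obtain ⟨h₀, hh₀, hleaf⟩ : ∃ h₀ : E × Bool, h₀.1 ∈ S ∧
      ((∃ h : E × Bool, h.1 ∈ S ∧ G.degree (G.vert h) = 1) → G.degree (G.vert h₀) = 1) := by
    by_cases hex : ∃ h : E × Bool, h.1 ∈ S ∧ G.degree (G.vert h) = 1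
    · obtain ⟨h, hh, hd⟩ := hex
      exact ⟨h, hh, fun _ => hd⟩
    · obtain ⟨e, he⟩ := hS
      exact ⟨(e, false), he, fun h => absurd h hex⟩
  -- The walk turns back only at leaves.
  have hnext : ∀ h : {h : E × Bool // h.1 ∈ S}, ∃ h' : {h : E × Bool // h.1 ∈ S},
      G.vert h'.1 = G.vert (opposite h.1) ∧
        (h'.1 = opposite h.1 → G.degree (G.vert h'.1) = 1) := by
    rintro ⟨h, hh⟩
    by_cases hd : G.degree (G.vert (opposite h)) = 1
    · exact ⟨⟨opposite h, hh⟩, rfl, fun _ => hd⟩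
    · obtain ⟨h', hne, hv, hs⟩ := hend (opposite h) hh hd
      exact ⟨⟨h', hs⟩, hv, fun he => absurd he hne⟩
  choose next hnextv hnextne using hnext
  let s : ℕ → {h : E × Bool // h.1 ∈ S} := fun i => next^[i] ⟨h₀, hh₀⟩
  let a : ℕ → E × Bool := fun i => (s i).1
  have haS : ∀ i, (a i).1 ∈ S := fun i => (s i).2
  have hs : ∀ i, s (i + 1) = next (s i) := fun i => Function.iterate_succ_apply' _ _ _
  have hav : ∀ i, G.vert (a (i + 1)) = G.vert (opposite (a i)) := fun i => by
    simp only [a, hs]; exact hnextv _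
  have hane : ∀ i, a (i + 1) = opposite (a i) → G.degree (G.vert (a (i + 1))) = 1 := fun i => by
    simp only [a, hs]; exact hnextne _
  have hjoin : ∀ i, G.Joins (a i).1 (G.vert (a i)) (G.vert (a (i + 1))) := fun i => by
    rw [hav]; exact joins_vert _
  have hrep : ∃ j, ∃ i < j, G.vert (a i) = G.vert (a j) := by
    obtain ⟨i, j, hij, he⟩ := Finite.exists_ne_map_eq_of_infinite fun i => G.vert (a i)
    rcases lt_or_gt_of_ne hij with h | h
    · exact ⟨j, i, h, he⟩
    · exact ⟨i, j, h, he.symm⟩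
  -- `j` is the first time at which a vertex is visited for the second time.
  obtain ⟨j, ⟨i, hij, hvij⟩, hmin⟩ : ∃ j, (∃ i < j, G.vert (a i) = G.vert (a j)) ∧
      ∀ k < j, ∀ i < k, G.vert (a i) ≠ G.vert (a k) :=
    ⟨Nat.find hrep, Nat.find_spec hrep, fun k hk i hi he => Nat.find_min hrep hk ⟨i, hi, he⟩⟩
  have hinj : ∀ p < j, ∀ q < j, G.vert (a p) = G.vert (a q) → p = q := by
    intro p hp q hq he
    rcases lt_trichotomy p q with h | h | h
    · exact absurd he (hmin q hq p h)
    · exact h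
    · exact absurd he.symm (hmin p hp q h)
  by_cases hb : ∃ b, 1 ≤ b ∧ b < j ∧ G.degree (G.vert (a b)) = 1
  · obtain ⟨b, hb1, hbj, hbd⟩ := hb
    obtain ⟨n, rfl⟩ : ∃ n, b = n + 1 := ⟨b - 1, by omega⟩
    let e : Fin (n + 1) → E := fun i => (a i).1
    refine ⟨Finset.univ.image e, Or.inr ⟨n, fun i => G.vert (a i), e, ?_, ?_, ?_, ?_, by simp⟩, ?_⟩
    · intro p q he
      exact Fin.ext (hinj p (by omega) q (by omega) he)
    · intro i
      simpa [e] using hjoin i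
    · exact hleaf ⟨a (n + 1), haS _, hbd⟩
    · simpa using hbd
    · intro f hf
      obtain ⟨i, -, rfl⟩ := Finset.mem_image.1 (Finset.mem_coe.1 hf)
      exact haS i
  · push Not at hb
    obtain ⟨n, rfl⟩ : ∃ n, j = i + n + 1 := ⟨j - i - 1, by omega⟩
    let e : Fin (n + 1) → E := fun k => (a (i + k)).1
    -- An edge cannot be traversed twice, since two consecutive half-edges are not opposite.
    have hlt : ∀ p q, i ≤ p → p < q → q < i + n + 1 → (a p).1 ≠ (a q).1 := by
      intro p q hp hpq hq he
      rcases eq_or_ne (a p) (a q) with h | h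
      · exact hpq.ne (hinj p (by omega) q hq (congrArg G.vert h))
      · have hop : a q = opposite (a p) := by
          refine Prod.ext he.symm ?_
          have : (a p).2 ≠ (a q).2 := fun h2 => h (Prod.ext he h2)
          exact (Bool.eq_not.2 this.symm)
        have h1 : G.vert (a q) = G.vert (a (p + 1)) := by rw [hop, hav]
        have hq1 := hinj q hq (p + 1) (by omega) h1
        subst hq1
        exact hb (p + 1) (by omega) hq (hane p hop)
    refine ⟨Finset.univ.image e,
      Or.inl ⟨n, fun k => G.vert (a (i + k)), e, ?_, ?_, ?_, by simp⟩, ?_⟩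
    · intro p q he
      have := hinj (i + p) (by omega) (i + q) (by omega) he
      exact Fin.ext (by omega)
    · intro p q he
      by_contra hne
      have hne' : (p : ℕ) ≠ q := fun h => hne (Fin.ext h)
      rcases lt_or_gt_of_ne hne' with h | h
      · exact hlt (i + p) (i + q) (by omega) (by omega) (by omega) he
      · exact hlt (i + q) (i + p) (by omega) (by omega) (by omega) he.symm
    · intro k
      have hk := hjoin (i + k)
      rcases eq_or_ne k (Fin.last n) with rfl | hne
      · simp only [Fin.last_add_one, Fin.val_last, Fin.val_zero, add_zero, e] at hk ⊢
        rwa [hvij]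
      · have hlt : k < Fin.last n := Fin.lt_last_iff_ne_last.2 hne
        simp only [Fin.val_add_one_of_lt hlt, e]
        exact hk
    · intro f hf
      obtain ⟨k, -, rfl⟩ := Finset.mem_image.1 (Finset.mem_coe.1 hf)
      exact haS _

end OrientedMultigraph

namespace OrientedMultigraph

variable {V E : Type*} (G : OrientedMultigraph V E) (l : Lengths E)

/-! ### The topology of the metric graph -/

lemma length_pos (e : E) : (0 : ℝ) < l e := (l e).2

instance [Finite E] : CompactSpace (G.Realization l) :=
  inferInstanceAs (CompactSpace (Quotient (G.gluing l)))

section Lift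

variable {α : Type*} (f : E → ℝ → α) (c : V → α) (hsrc : ∀ e, f e (-(l e : ℝ) / 2) = c (G.src e))
  (htgt : ∀ e, f e ((l e : ℝ) / 2) = c (G.tgt e))

/-- The function on `|G|` that is given by the function `f e` on each edge `e`, and by the function
`c` at the vertices. -/
def liftEdges : G.Realization l → α :=
  Quotient.lift (fun p : Σ e, EdgeInterval l e => f p.1 p.2) (by
    have hc : ∀ (p : Σ e, EdgeInterval l e) (v : V), G.EndsAt l p v → f p.1 p.2 = c v := by
      rintro p v (⟨hp, rfl⟩ | ⟨hp, rfl⟩)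
      · rw [hp, hsrc]
      · rw [hp, htgt]
    rintro p q (rfl | ⟨v, hp, hq⟩)
    · rfl
    · rw [hc p v hp, hc q v hq])

lemma continuous_liftEdges [TopologicalSpace α] (hf : ∀ e, Continuous (f e)) :
    Continuous (G.liftEdges l f c hsrc htgt) :=
  continuous_quot_lift _ (continuous_sigma fun e => (hf e).comp continuous_subtype_val)

end Lift

lemma exists_edgeMap_eq (p : G.Realization l) : ∃ e t, G.edgeMap l e t = p := by
  obtain ⟨⟨e, t⟩, rfl⟩ := Quotient.exists_rep p
  exact ⟨e, t, rfl⟩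

lemma edgeMap_eq_iff {e e' : E} {t : EdgeInterval l e} {t' : EdgeInterval l e'} :
    G.edgeMap l e t = G.edgeMap l e' t' ↔
      (⟨e, t⟩ : Σ e, EdgeInterval l e) = ⟨e', t'⟩ ∨
        ∃ v, G.EndsAt l ⟨e, t⟩ v ∧ G.EndsAt l ⟨e', t'⟩ v :=
  Quotient.eq (r := G.gluing l)

/-- The midpoint of an edge. -/
noncomputable def midpoint (e : E) : EdgeInterval l e :=
  ⟨0, by have := length_pos l e; constructor <;> linarith⟩

/-- The metric graph is metrizable: finitely many continuous real functions separate its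
points. -/
instance metrizableSpace_realization [Finite V] [Finite E] :
    TopologicalSpace.MetrizableSpace (G.Realization l) := by
  classical
  have := Fintype.ofFinite V
  have := Fintype.ofFinite E
  -- functions which separate the points of the open edge `e₀` from one another and from the rest
  let A : E → G.Realization l → ℝ := fun e₀ => G.liftEdges l
    (fun e t => if e = e₀ then ((l e : ℝ) / 2) ^ 2 - t ^ 2 else 0) (fun _ => 0)
    (fun e => by split_ifs <;> ring) (fun e => by split_ifs <;> ring)
  let B : E → G.Realization l → ℝ := fun e₀ => G.liftEdges l
    (fun e t => if e = e₀ then t * (((l e : ℝ) / 2) ^ 2 - t ^ 2) else 0) (fun _ => 0)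
    (fun e => by split_ifs <;> ring) (fun e => by split_ifs <;> ring)
  -- functions which separate the vertices, affine on the edges
  let C : V → G.Realization l → ℝ := fun v => G.liftEdges l
    (fun e t => (if G.src e = v then (1 : ℝ) else 0) * (((l e : ℝ) / 2 - t) / l e) +
      (if G.tgt e = v then (1 : ℝ) else 0) * ((t + (l e : ℝ) / 2) / l e))
    (fun w => if w = v then 1 else 0)
    (fun e => by have := length_pos l e; field_simp; ring)
    (fun e => by have := length_pos l e; field_simp; ring)
  have hA : ∀ e, Continuous (A e) := fun e₀ => G.continuous_liftEdges l _ _ _ _ fun e => by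
    split_ifs <;> fun_prop
  have hB : ∀ e, Continuous (B e) := fun e₀ => G.continuous_liftEdges l _ _ _ _ fun e => by
    split_ifs <;> fun_prop
  have hC : ∀ v, Continuous (C v) := fun v => G.continuous_liftEdges l _ _ _ _ fun e => by
    fun_prop
  let Φ : G.Realization l → (E → ℝ) × (E → ℝ) × (V → ℝ) := fun p =>
    (fun e => A e p, fun e => B e p, fun v => C v p)
  have hΦ : Continuous Φ := by
    refine (continuous_pi hA).prodMk ((continuous_pi hB).prodMk (continuous_pi hC))
  have hAval : ∀ e₀ e (t : EdgeInterval l e), A e₀ (G.edgeMap l e t) =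
      if e = e₀ then ((l e : ℝ) / 2) ^ 2 - (t : ℝ) ^ 2 else 0 := fun _ _ _ => rfl
  have hBval : ∀ e₀ e (t : EdgeInterval l e), B e₀ (G.edgeMap l e t) =
      if e = e₀ then (t : ℝ) * (((l e : ℝ) / 2) ^ 2 - (t : ℝ) ^ 2) else 0 := fun _ _ _ => rfl
  have hCval : ∀ e (t : EdgeInterval l e) w, G.EndsAt l ⟨e, t⟩ w → ∀ v, C v (G.edgeMap l e t) =
      if w = v then 1 else 0 := by
    have hCval' : ∀ v e (t : EdgeInterval l e), C v (G.edgeMap l e t) =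
      (if G.src e = v then (1 : ℝ) else 0) * (((l e : ℝ) / 2 - t) / l e) +
      (if G.tgt e = v then (1 : ℝ) else 0) * ((t + (l e : ℝ) / 2) / l e) := fun _ _ _ => rfl
    rintro e t w (⟨ht, rfl⟩ | ⟨ht, rfl⟩) v <;>
    · have := length_pos l e
      simp only at ht
      rw [hCval', ht]
      field_simp
      ring
  have hends : ∀ e (t : EdgeInterval l e), ((l e : ℝ) / 2) ^ 2 - (t : ℝ) ^ 2 = 0 →
      ∃ v, G.EndsAt l ⟨e, t⟩ v := by
    intro e t ht
    have h0 : ((t : ℝ) - -(l e : ℝ) / 2) * ((t : ℝ) - (l e : ℝ) / 2) = 0 := by linarith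
    rcases mul_eq_zero.1 h0 with h | h
    · exact ⟨_, Or.inl ⟨sub_eq_zero.1 h, rfl⟩⟩
    · exact ⟨_, Or.inr ⟨sub_eq_zero.1 h, rfl⟩⟩
  have hinj : Function.Injective Φ := by
    intro p q hpq
    obtain ⟨e, t, rfl⟩ := G.exists_edgeMap_eq l p
    obtain ⟨e', t', rfl⟩ := G.exists_edgeMap_eq l q
    have hA' := fun i => congrFun (congrArg Prod.fst hpq) i
    have hB' := fun i => congrFun (congrArg (fun r => r.2.1) hpq) i
    have hC' := fun i => congrFun (congrArg (fun r => r.2.2) hpq) i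
    simp only [Φ] at hA' hB' hC'
    simp only [hAval, hBval] at hA' hB'
    by_cases h0 : ((l e : ℝ) / 2) ^ 2 - (t : ℝ) ^ 2 = 0
    · by_cases h1 : ((l e' : ℝ) / 2) ^ 2 - (t' : ℝ) ^ 2 = 0
      · obtain ⟨v, hv⟩ := hends e t h0
        obtain ⟨w, hw⟩ := hends e' t' h1
        have hvw : v = w := by
          have := hC' v
          rw [hCval _ _ _ hv, hCval _ _ _ hw, if_pos rfl] at this
          by_contra hne
          rw [if_neg (Ne.symm hne)] at this
          exact one_ne_zero this
        subst hvw
        exact (G.edgeMap_eq_iff l).2 (Or.inr ⟨v, hv, hw⟩)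
      · have := hA' e'
        rw [if_pos rfl] at this
        split_ifs at this with he
        · exact absurd (this.symm.trans h0) h1
        · exact absurd this.symm h1
    · have h2 := hA' e
      have h3 := hB' e
      rw [if_pos rfl] at h2 h3
      split_ifs at h2 h3 with he
      · subst he
        rw [← h2] at h3
        rw [Subtype.ext (mul_right_cancel₀ h0 h3)]
      · exact absurd h2 h0
  exact (hΦ.isClosedEmbedding hinj).isEmbedding.metrizableSpace

/-! ### Measures which are uniform on the edges -/

variable {l}

lemma mem_of_edgeMap_midpoint_mem_carrier {γ : Finset E} {e : E}
    (h : G.edgeMap l e (midpoint l e) ∈ G.carrier l γ) : e ∈ γ := by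
  simp only [carrier, Set.mem_iUnion, Set.mem_range, exists_prop] at h
  obtain ⟨e', he', t, ht⟩ := h
  rcases (G.edgeMap_eq_iff l).1 ht with h | ⟨v, -, h⟩
  · obtain rfl : e' = e := congrArg Sigma.fst h
    exact he'
  · have := length_pos l e
    rcases h with ⟨h, -⟩ | ⟨h, -⟩ <;> simp only [midpoint] at h <;> linarith

lemma carrier_subset_carrier_iff {γ γ' : Finset E} :
    G.carrier l γ ⊆ G.carrier l γ' ↔ γ ⊆ γ' := by
  constructor
  · intro h e he
    exact G.mem_of_edgeMap_midpoint_mem_carrier (h (Set.mem_biUnion he ⟨_, rfl⟩))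
  · exact fun h => Set.biUnion_subset_biUnion_left h

lemma isClosed_carrier [Finite V] [Finite E] (γ : Finset E) : IsClosed (G.carrier l γ) :=
  γ.finite_toSet.isClosed_biUnion fun e _ =>
    (isCompact_range (G.continuous_edgeMap l e)).isClosed

lemma coe_edgeMeasure (e : E) : (G.edgeMeasure l e : Measure (G.Realization l)) =
    Measure.map (G.edgeMap l e) (intervalMeasure l e) := rfl

lemma intervalMeasure_pos {e : E} {W : Set (EdgeInterval l e)} (hW : IsOpen W)
    (hne : W.Nonempty) : 0 < intervalMeasure l e W := by
  rw [intervalMeasure, (MeasurableEmbedding.subtype_coe measurableSet_Icc).comap_apply]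
  obtain ⟨O, hO, rfl⟩ := isOpen_induced_iff.1 hW
  obtain ⟨t, ht⟩ := hne
  have hlt : -(l e : ℝ) / 2 < (l e : ℝ) / 2 := by have := length_pos l e; linarith
  have hcl : (t : ℝ) ∈ closure (Set.Ioo (-(l e : ℝ) / 2) ((l e : ℝ) / 2)) := by
    rw [closure_Ioo hlt.ne]; exact t.2
  have hpos : 0 < volume (O ∩ Set.Ioo (-(l e : ℝ) / 2) ((l e : ℝ) / 2)) :=
    (hO.inter isOpen_Ioo).measure_pos _ (mem_closure_iff.1 hcl O hO ht)
  refine hpos.trans_le (measure_mono ?_)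
  rintro s ⟨hs, hs'⟩
  exact ⟨⟨s, Set.Ioo_subset_Icc_self hs'⟩, hs, rfl⟩

lemma edgeMeasure_pos {e : E} {U : Set (G.Realization l)} (hU : IsOpen U) {t : EdgeInterval l e}
    (ht : G.edgeMap l e t ∈ U) : 0 < (G.edgeMeasure l e : Measure (G.Realization l)) U := by
  rw [coe_edgeMeasure, Measure.map_apply (G.measurable_edgeMap l e) hU.measurableSet]
  exact intervalMeasure_pos (hU.preimage (G.continuous_edgeMap l e)) ⟨t, ht⟩

lemma edgeMeasure_compl_carrier [Finite V] [Finite E] {γ : Finset E} {e : E} (he : e ∈ γ) :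
    (G.edgeMeasure l e : Measure (G.Realization l)) (G.carrier l γ)ᶜ = 0 := by
  rw [coe_edgeMeasure, Measure.map_apply (G.measurable_edgeMap l e)
    (G.isClosed_carrier γ).isOpen_compl.measurableSet]
  convert measure_empty (μ := intervalMeasure l e)
  ext t
  simp only [Set.mem_preimage, Set.mem_compl_iff, Set.mem_empty_iff_false, iff_false, not_not]
  exact Set.mem_biUnion he ⟨t, rfl⟩

lemma mass_subgraphMeasure_ne_zero {γ : Finset E} (hγ : γ.Nonempty) :
    (G.subgraphMeasure l γ).mass ≠ 0 := by
  obtain ⟨e, he⟩ := hγ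
  intro h
  rw [FiniteMeasure.mass_zero_iff] at h
  have h1 := congrArg (fun μ : FiniteMeasure (G.Realization l) =>
    (μ : Measure (G.Realization l)) Set.univ) h
  simp only [subgraphMeasure, FiniteMeasure.toMeasure_sum, Measure.coe_finsetSum,
    Finset.sum_apply, FiniteMeasure.toMeasure_zero, Measure.coe_zero, Pi.zero_apply,
    Finset.sum_eq_zero_iff] at h1
  exact (G.edgeMeasure_pos (l := l) isOpen_univ (t := midpoint l e) trivial).ne' (h1 e he)

section Fintype

variable [Fintype E]

variable (l) in
/-- The measure `∑ m_e |dt_e|` with the constant density `m e` on each edge `e`. -/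
noncomputable def edgewiseMeasure (m : E → ℝ≥0) : FiniteMeasure (G.Realization l) :=
  ∑ e, m e • G.edgeMeasure l e

lemma coe_edgewiseMeasure (m : E → ℝ≥0) :
    (G.edgewiseMeasure l m : Measure (G.Realization l)) =
      ∑ e, (m e : ℝ≥0∞) • (G.edgeMeasure l e : Measure (G.Realization l)) := by
  rw [edgewiseMeasure, FiniteMeasure.toMeasure_sum]
  rfl

lemma edgewiseMeasure_apply (m : E → ℝ≥0) (U : Set (G.Realization l)) :
    (G.edgewiseMeasure l m : Measure (G.Realization l)) U =
      ∑ e, (m e : ℝ≥0∞) * (G.edgeMeasure l e : Measure (G.Realization l)) U := by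
  rw [coe_edgewiseMeasure]
  simp

lemma edgewiseMeasure_smul (c : ℝ≥0) (m : E → ℝ≥0) :
    G.edgewiseMeasure l (fun e => c * m e) = c • G.edgewiseMeasure l m := by
  simp only [edgewiseMeasure, Finset.smul_sum, smul_smul]

lemma edgewiseMeasure_eq_smul {m : E → ℝ≥0} {γ : Finset E} {c : ℝ≥0} (h1 : ∀ e ∈ γ, m e = c)
    (h2 : ∀ e ∉ γ, m e = 0) : G.edgewiseMeasure l m = c • G.subgraphMeasure l γ := by
  classical
  rw [edgewiseMeasure, subgraphMeasure, Finset.smul_sum,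
    ← Finset.sum_subset (Finset.subset_univ γ) fun e _ he => by rw [h2 e he, zero_smul]]
  exact Finset.sum_congr rfl fun e he => by rw [h1 e he]

lemma edgewiseMeasure_ne_zero {m : E → ℝ≥0} {e : E} (he : m e ≠ 0) :
    G.edgewiseMeasure l m ≠ 0 := by
  intro h
  have h1 := congrArg (fun μ : FiniteMeasure (G.Realization l) =>
    (μ : Measure (G.Realization l)) Set.univ) h
  simp only [edgewiseMeasure_apply, FiniteMeasure.toMeasure_zero, Measure.coe_zero, Pi.zero_apply,
    Finset.sum_eq_zero_iff, mul_eq_zero, ENNReal.coe_eq_zero] at h1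
  rcases h1 e (Finset.mem_univ e) with h2 | h2
  · exact he h2
  · exact (G.edgeMeasure_pos (l := l) isOpen_univ (t := midpoint l e) trivial).ne' h2

open Classical in
lemma support_edgewiseMeasure [Finite V] (m : E → ℝ≥0) :
    (G.edgewiseMeasure l m : Measure (G.Realization l)).support =
      G.carrier l {e | m e ≠ 0} := by
  apply Set.Subset.antisymm
  · refine Measure.support_subset_of_isClosed (G.isClosed_carrier _) ?_
    rw [mem_ae_iff, edgewiseMeasure_apply]
    refine Finset.sum_eq_zero fun e _ => ?_
    by_cases he : m e = 0
    · simp [he]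
    · rw [G.edgeMeasure_compl_carrier (by simp [he]), mul_zero]
  · intro p hp
    simp only [carrier, Set.mem_iUnion, Set.mem_range, exists_prop, Finset.mem_filter,
      Finset.mem_univ, true_and] at hp
    obtain ⟨e, he, t, rfl⟩ := hp
    rw [Measure.mem_support_iff_forall]
    intro U hU
    obtain ⟨O, hOU, hO, hpO⟩ := mem_nhds_iff.1 hU
    refine lt_of_lt_of_le ?_ (measure_mono hOU)
    rw [edgewiseMeasure_apply]
    refine lt_of_lt_of_le ?_ (Finset.single_le_sum (fun _ _ => zero_le)
      (Finset.mem_univ e))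
    exact ENNReal.mul_pos (by simpa using he) (G.edgeMeasure_pos hO hpO).ne'

end Fintype

end OrientedMultigraph

namespace OrientedMultigraph

variable {V E : Type*} {G : OrientedMultigraph V E} {l : Lengths E}

/-! ### Eigenfunctions as sums of progressive waves -/

/-- The wave of frequency `k` on the edge `e` whose amplitudes at the two ends are given by `x`. -/
noncomputable def wave (l : Lengths E) (k : ℝ) (x : E × Bool → ℂ) (e : E) (t : ℝ) : ℂ :=
  x (e, false) * Complex.exp ((k * (t + (l e : ℝ) / 2) : ℝ) * Complex.I) +
    x (e, true) * Complex.exp ((k * ((l e : ℝ) / 2 - t) : ℝ) * Complex.I)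

/-- The derivative of the wave, divided by `i k`. -/
noncomputable def waveDeriv (l : Lengths E) (k : ℝ) (x : E × Bool → ℂ) (e : E) (t : ℝ) : ℂ :=
  x (e, false) * Complex.exp ((k * (t + (l e : ℝ) / 2) : ℝ) * Complex.I) -
    x (e, true) * Complex.exp ((k * ((l e : ℝ) / 2 - t) : ℝ) * Complex.I)

section Wave

variable (l) (k : ℝ) (x : E × Bool → ℂ) (e : E)

lemma hasDerivAt_exp_mul_I {f : ℝ → ℝ} {f' t : ℝ} (hf : HasDerivAt f f' t) :
    HasDerivAt (fun t => Complex.exp ((f t : ℝ) * Complex.I))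
      (Complex.exp ((f t : ℝ) * Complex.I) * ((f' : ℂ) * Complex.I)) t :=
  (hf.ofReal_comp.mul_const Complex.I).cexp

lemma hasDerivAt_wave (t : ℝ) :
    HasDerivAt (wave l k x e) (Complex.I * k * waveDeriv l k x e t) t := by
  have h1 : HasDerivAt (fun t : ℝ => k * (t + (l e : ℝ) / 2)) k t := by
    simpa using ((hasDerivAt_id t).add_const ((l e : ℝ) / 2)).const_mul k
  have h2 : HasDerivAt (fun t : ℝ => k * ((l e : ℝ) / 2 - t)) (-k) t := by
    simpa using ((hasDerivAt_id t).const_sub ((l e : ℝ) / 2)).const_mul k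
  refine (((hasDerivAt_exp_mul_I h1).const_mul (x (e, false))).add
    ((hasDerivAt_exp_mul_I h2).const_mul (x (e, true)))).congr_deriv ?_
  rw [waveDeriv]
  push_cast
  ring

lemma hasDerivAt_waveDeriv (t : ℝ) :
    HasDerivAt (waveDeriv l k x e) (Complex.I * k * wave l k x e t) t := by
  have h1 : HasDerivAt (fun t : ℝ => k * (t + (l e : ℝ) / 2)) k t := by
    simpa using ((hasDerivAt_id t).add_const ((l e : ℝ) / 2)).const_mul k
  have h2 : HasDerivAt (fun t : ℝ => k * ((l e : ℝ) / 2 - t)) (-k) t := by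
    simpa using ((hasDerivAt_id t).const_sub ((l e : ℝ) / 2)).const_mul k
  refine (((hasDerivAt_exp_mul_I h1).const_mul (x (e, false))).sub
    ((hasDerivAt_exp_mul_I h2).const_mul (x (e, true)))).congr_deriv ?_
  rw [wave]
  push_cast
  ring

lemma continuous_wave : Continuous (wave l k x e) :=
  continuous_iff_continuousAt.2 fun t => (hasDerivAt_wave l k x e t).continuousAt

lemma continuous_waveDeriv : Continuous (waveDeriv l k x e) :=
  continuous_iff_continuousAt.2 fun t => (hasDerivAt_waveDeriv l k x e t).continuousAt

lemma norm_wave_le (t : ℝ) : ‖wave l k x e t‖ ≤ ‖x (e, false)‖ + ‖x (e, true)‖ := by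
  refine (norm_add_le _ _).trans ?_
  rw [norm_mul, norm_mul, Complex.norm_exp_ofReal_mul_I, Complex.norm_exp_ofReal_mul_I, mul_one,
    mul_one]

/-- The phases of the edges of the metric graph. -/
noncomputable abbrev edgePhases (l : Lengths E) (k : ℝ) : E → ℂ := phases (fun e => (l e : ℝ)) k

lemma wave_left : wave l k x e (-(l e : ℝ) / 2) =
    x (e, false) + edgePhases l k e * x (e, true) := by
  rw [wave, edgePhases, phases, show k * (-(l e : ℝ) / 2 + (l e : ℝ) / 2) = 0 by ring,
    show k * ((l e : ℝ) / 2 - -(l e : ℝ) / 2) = k * l e by ring]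
  simp [mul_comm]

lemma wave_right : wave l k x e ((l e : ℝ) / 2) =
    x (e, true) + edgePhases l k e * x (e, false) := by
  rw [wave, edgePhases, phases, show k * ((l e : ℝ) / 2 + (l e : ℝ) / 2) = k * l e by ring,
    show k * ((l e : ℝ) / 2 - (l e : ℝ) / 2) = 0 by ring]
  simp [mul_comm, add_comm]

lemma waveDeriv_left : waveDeriv l k x e (-(l e : ℝ) / 2) =
    x (e, false) - edgePhases l k e * x (e, true) := by
  rw [waveDeriv, edgePhases, phases, show k * (-(l e : ℝ) / 2 + (l e : ℝ) / 2) = 0 by ring,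
    show k * ((l e : ℝ) / 2 - -(l e : ℝ) / 2) = k * l e by ring]
  simp [mul_comm]

lemma waveDeriv_right : waveDeriv l k x e ((l e : ℝ) / 2) =
    -(x (e, true) - edgePhases l k e * x (e, false)) := by
  rw [waveDeriv, edgePhases, phases, show k * ((l e : ℝ) / 2 + (l e : ℝ) / 2) = k * l e by ring,
    show k * ((l e : ℝ) / 2 - (l e : ℝ) / 2) = 0 by ring]
  simp [mul_comm]

end Wave

/-- If `φ` is a primitive of `g`, and `g` a primitive of `-k² φ`, then `g + i k φ` is a progressive
wave. -/
lemma add_mul_eq_of_primitives {a b : ℝ} (hab : a ≤ b) (k : ℝ) {φ g h : ℝ → ℂ}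
    (hφc : ContinuousOn φ (Set.Icc a b))
    (hg : ∀ t ∈ Set.Icc a b, g t = g a + ∫ s in a..t, h s)
    (hφ : ∀ t ∈ Set.Icc a b, φ t = φ a + ∫ s in a..t, g s)
    (hh : ∀ᵐ t ∂volume.restrict (Set.Icc a b), (k : ℂ) ^ 2 * φ t = -h t)
    {t : ℝ} (ht : t ∈ Set.Icc a b) :
    g t + Complex.I * k * φ t =
      (g a + Complex.I * k * φ a) * Complex.exp ((k * (t - a) : ℝ) * Complex.I) := by
  -- `f`, `g'`, `φ'` are extensions of `φ`, `g`, `φ` to the real line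
  let f : ℝ → ℂ := Set.IccExtend hab ((Set.Icc a b).domRestrict φ)
  have hf : Continuous f := (continuousOn_iff_continuous_domRestrict.1 hφc).Icc_extend'
  have hfφ : ∀ t ∈ Set.Icc a b, f t = φ t := fun t ht => Set.IccExtend_of_mem hab _ ht
  let g' : ℝ → ℂ := fun t => g a + ∫ s in a..t, -(k : ℂ) ^ 2 * f s
  have hg'd : ∀ t, HasDerivAt g' (-(k : ℂ) ^ 2 * f t) t := fun t =>
    ((by fun_prop : Continuous fun s => -(k : ℂ) ^ 2 * f s).integral_hasStrictDerivAt a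
      t).hasDerivAt.const_add _
  have hg'c : Continuous g' := continuous_iff_continuousAt.2 fun t => (hg'd t).continuousAt
  have hgg' : ∀ t ∈ Set.Icc a b, g t = g' t := by
    intro t ht
    rw [hg t ht]
    simp only [g']
    congr 1
    refine intervalIntegral.integral_congr_ae_restrict ?_
    rw [Set.uIoc_of_le ht.1]
    have hsub : Set.Ioc a t ⊆ Set.Icc a b := fun s hs => ⟨hs.1.le, hs.2.trans ht.2⟩
    filter_upwards [ae_restrict_of_ae_restrict_of_subset hsub hh,
      ae_restrict_mem measurableSet_Ioc] with s hs hs'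
    rw [hfφ s (hsub hs'), neg_mul, hs, neg_neg]
  let φ' : ℝ → ℂ := fun t => φ a + ∫ s in a..t, g' s
  have hφ'd : ∀ t, HasDerivAt φ' (g' t) t := fun t =>
    (hg'c.integral_hasStrictDerivAt a t).hasDerivAt.const_add _
  have hφφ' : ∀ t ∈ Set.Icc a b, φ t = φ' t := by
    intro t ht
    rw [hφ t ht]
    simp only [φ']
    congr 1
    refine intervalIntegral.integral_congr fun s hs => hgg' s ?_
    rw [Set.uIcc_of_le ht.1] at hs
    exact ⟨hs.1, hs.2.trans ht.2⟩
  let u : ℝ → ℂ := fun t => (g' t + Complex.I * k * φ' t) *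
    Complex.exp ((k * (a - t) : ℝ) * Complex.I)
  have hud : ∀ t ∈ Set.Icc a b, HasDerivAt u 0 t := by
    intro t ht
    have h1 : HasDerivAt (fun t : ℝ => k * (a - t)) (-k) t := by
      simpa using ((hasDerivAt_id t).const_sub a).const_mul k
    have h2 : HasDerivAt (fun t => g' t + Complex.I * k * φ' t)
        (-(k : ℂ) ^ 2 * f t + Complex.I * k * g' t) t :=
      (hg'd t).add ((hφ'd t).const_mul (Complex.I * k))
    refine (h2.mul (hasDerivAt_exp_mul_I h1)).congr_deriv ?_
    rw [hfφ t ht, hφφ' t ht]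
    generalize g' t = α at *
    generalize φ' t = β at *
    push_cast
    linear_combination (-(k : ℂ) ^ 2 * β *
      Complex.exp ((k * (a - t)) * Complex.I)) * Complex.I_sq
  have hconst := constant_of_has_deriv_right_zero
    (fun t ht => (hud t ht).continuousAt.continuousWithinAt)
    (fun t ht => (hud t (Set.Ico_subset_Icc_self ht)).hasDerivWithinAt) t ht
  have ha : a ∈ Set.Icc a b := Set.left_mem_Icc.2 hab
  simp only [u, sub_self, mul_zero, Complex.ofReal_zero, zero_mul, Complex.exp_zero,
    mul_one, ← hgg' t ht, ← hφφ' t ht, ← hgg' a ha, ← hφφ' a ha] at hconst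
  rw [← hconst, mul_assoc (g t + Complex.I * k * φ t), ← Complex.exp_add]
  push_cast
  ring_nf
  simp

section Fintype

variable [Fintype E]

open Classical in
lemma sum_vert (v : V) (F : E × Bool → ℂ) :
    ∑ h with G.vert h = v, F h =
      ∑ e with G.src e = v, F (e, false) + ∑ e with G.tgt e = v, F (e, true) := by
  simp only [Finset.sum_filter]
  rw [Fintype.sum_prod_type, ← Finset.sum_add_distrib]
  refine Finset.sum_congr rfl fun e _ => ?_
  rw [Fintype.sum_bool, add_comm]
  rfl

/-- An eigenfunction is on each edge a sum of two progressive waves; their amplitudes satisfy the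
vertex conditions. -/
theorem IsEigenfunction.exists_wave {k : ℝ} (hk : k ≠ 0) {φ : G.Realization l → ℂ}
    (hφ : G.IsEigenfunction l (k ^ 2) φ) :
    ∃ x, x ≠ 0 ∧ G.VertexConditions (edgePhases l k) x ∧
      ∀ e t, φ (G.edgeMap l e t) = wave l k x e t := by
  classical
  obtain ⟨hφ0, hφc, g, h, -, hg, hφg, hkir, hψ⟩ := hφ
  have hkC : (k : ℂ) ≠ 0 := by exact_mod_cast hk
  have hIk : Complex.I * (k : ℂ) ≠ 0 := mul_ne_zero Complex.I_ne_zero hkC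
  let f : E → ℝ → ℂ := fun e => Set.IccExtend (half_nonneg l e) fun t => φ (G.edgeMap l e t)
  have hf : ∀ e (t : EdgeInterval l e), f e t = φ (G.edgeMap l e t) := fun e t =>
    Set.IccExtend_of_mem _ _ t.2
  have hfc : ∀ e, Continuous (f e) := fun e => (hφc.comp (G.continuous_edgeMap l e)).Icc_extend'
  have hleft : ∀ e, f e (-(l e : ℝ) / 2) = φ (G.edgeMap l e (leftEnd l e)) := fun e =>
    hf e (leftEnd l e)
  have hright : ∀ e, f e ((l e : ℝ) / 2) = φ (G.edgeMap l e (rightEnd l e)) := fun e =>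
    hf e (rightEnd l e)
  have key : ∀ (κ : ℝ), κ ^ 2 = k ^ 2 → ∀ e, ∀ t ∈ Set.Icc (-(l e : ℝ) / 2) ((l e : ℝ) / 2),
      g e t + Complex.I * κ * f e t = (g e (-(l e : ℝ) / 2) + Complex.I * κ *
        f e (-(l e : ℝ) / 2)) * Complex.exp ((κ * (t - -(l e : ℝ) / 2) : ℝ) * Complex.I) := by
    intro κ hκ e t ht
    refine add_mul_eq_of_primitives (half_nonneg l e) κ (hfc e).continuousOn
      (fun t ht => hg e ⟨t, ht⟩) (fun t ht => ?_) ?_ ht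
    · rw [hleft, ← hφg e ⟨t, ht⟩]
      exact hf e ⟨t, ht⟩
    · rw [ae_restrict_iff_subtype measurableSet_Icc]
      filter_upwards [hψ e] with t ht
      rw [← ht, hf]
      have : (κ : ℂ) ^ 2 = ((k ^ 2 : ℝ) : ℂ) := by rw [← hκ]; push_cast; rfl
      rw [this]
  let x : E × Bool → ℂ := fun h => if h.2 then
    (f h.1 ((l h.1 : ℝ) / 2) - g h.1 ((l h.1 : ℝ) / 2) / (Complex.I * k)) / 2
    else (f h.1 (-(l h.1 : ℝ) / 2) + g h.1 (-(l h.1 : ℝ) / 2) / (Complex.I * k)) / 2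
  have hxf : ∀ e, x (e, false) =
    (f e (-(l e : ℝ) / 2) + g e (-(l e : ℝ) / 2) / (Complex.I * k)) / 2 := fun _ => rfl
  have hxt : ∀ e, x (e, true) =
    (f e ((l e : ℝ) / 2) - g e ((l e : ℝ) / 2) / (Complex.I * k)) / 2 := fun _ => rfl
  have hboth : ∀ e, ∀ t ∈ Set.Icc (-(l e : ℝ) / 2) ((l e : ℝ) / 2),
      f e t = wave l k x e t ∧ g e t = Complex.I * k * waveDeriv l k x e t := by
    intro e t ht
    have h1 := key k rfl e t ht
    have h2 := key (-k) (by ring) e t ht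
    have h3 := key (-k) (by ring) e _ (Set.right_mem_Icc.2 (half_nonneg l e))
    rw [show (-k * ((l e : ℝ) / 2 - -(l e : ℝ) / 2)) = -k * l e by ring] at h3
    rw [show (-k * (t - -(l e : ℝ) / 2)) = -k * l e + k * ((l e : ℝ) / 2 - t) by ring,
      Complex.ofReal_add, add_mul (Complex.ofReal _), Complex.exp_add, ← mul_assoc] at h2
    rw [← h3] at h2
    rw [show (k * (t - -(l e : ℝ) / 2)) = k * (t + (l e : ℝ) / 2) by ring] at h1
    have hx1 : 2 * (Complex.I * k) * x (e, false) =
        g e (-(l e : ℝ) / 2) + Complex.I * k * f e (-(l e : ℝ) / 2) := by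
      rw [hxf]; field_simp; ring
    have hx2 : -(2 * (Complex.I * k) * x (e, true)) =
        g e ((l e : ℝ) / 2) + Complex.I * (-k : ℝ) * f e ((l e : ℝ) / 2) := by
      rw [hxt]; push_cast; field_simp; ring
    rw [← hx1] at h1
    rw [← hx2] at h2
    push_cast at h2 h1
    have h2k : 2 * (Complex.I * (k : ℂ)) ≠ 0 := mul_ne_zero two_ne_zero hIk
    constructor
    · apply mul_left_cancel₀ h2k
      rw [wave]
      push_cast
      linear_combination h1 - h2
    · rw [waveDeriv]
      push_cast
      linear_combination (h1 + h2) / 2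
  have hwave : ∀ e t, φ (G.edgeMap l e t) = wave l k x e t := fun e t => by
    rw [← hf]; exact (hboth e t t.2).1
  refine ⟨x, fun hx => hφ0 ?_, ⟨⟨fun v => if hv : ∃ p : Σ e, EdgeInterval l e, G.EndsAt l p v then
      φ (G.edgeMap l hv.choose.1 hv.choose.2) else 0, ?_⟩, fun v => ?_⟩, hwave⟩
  · ext p
    obtain ⟨e, t, rfl⟩ := G.exists_edgeMap_eq l p
    rw [hwave, hx]
    simp [wave]
  · have hc : ∀ (p : Σ e, EdgeInterval l e) v, G.EndsAt l p v →
        φ (G.edgeMap l p.1 p.2) = if hv : ∃ p : Σ e, EdgeInterval l e, G.EndsAt l p v then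
          φ (G.edgeMap l hv.choose.1 hv.choose.2) else 0 := by
      intro p v hp
      have hv : ∃ p : Σ e, EdgeInterval l e, G.EndsAt l p v := ⟨p, hp⟩
      rw [dif_pos hv]
      exact congrArg φ ((G.edgeMap_eq_iff l).2 (Or.inr ⟨v, hp, hv.choose_spec⟩))
    rintro ⟨e, b | b⟩
    · refine Eq.trans ?_ (hc ⟨e, leftEnd l e⟩ (G.src e) (Or.inl ⟨rfl, rfl⟩))
      rw [hwave]
      exact (wave_left l k x e).symm
    · refine Eq.trans ?_ (hc ⟨e, rightEnd l e⟩ (G.tgt e) (Or.inr ⟨rfl, rfl⟩))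
      rw [hwave]
      exact (wave_right l k x e).symm
  · rw [show (∑ h with G.vert h = v, (x h - edgePhases l k h.1 * x (opposite h))) = _ from
      (Finset.sum_congr (by congr) fun _ _ => rfl).trans (sum_vert v _)]
    apply mul_left_cancel₀ hIk
    rw [mul_zero, ← hkir v, mul_add, Finset.mul_sum, Finset.mul_sum]
    congr 1
    · refine Finset.sum_congr (by congr) fun e _ => ?_
      rw [(hboth e _ (Set.left_mem_Icc.2 (half_nonneg l e))).2, waveDeriv_left]
      rfl
    · refine Finset.sum_congr (by congr) fun e _ => ?_
      rw [(hboth e _ (Set.right_mem_Icc.2 (half_nonneg l e))).2, waveDeriv_right]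
      simp only [opposite_mk, Bool.not_true]
      ring

/-- Non-zero amplitudes which satisfy the vertex conditions define an eigenfunction. -/
theorem VertexConditions.exists_isEigenfunction {k : ℝ} (hk : k ≠ 0) {x : E × Bool → ℂ}
    (hx0 : x ≠ 0) (hx : G.VertexConditions (edgePhases l k) x) :
    ∃ φ : G.Realization l → ℂ, G.IsEigenfunction l (k ^ 2) φ ∧
      ∀ e t, φ (G.edgeMap l e t) = wave l k x e t := by
  classical
  have hIk : Complex.I * (k : ℂ) ≠ 0 := by simp [hk]
  obtain ⟨⟨c, hc⟩, hkir⟩ := hx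
  have hsrc : ∀ e, wave l k x e (-(l e : ℝ) / 2) = c (G.src e) := fun e => by
    rw [wave_left]; exact hc (e, false)
  have htgt : ∀ e, wave l k x e ((l e : ℝ) / 2) = c (G.tgt e) := fun e => by
    rw [wave_right]; exact hc (e, true)
  let φ := G.liftEdges l (wave l k x) c hsrc htgt
  have hφ : ∀ e t, φ (G.edgeMap l e t) = wave l k x e t := fun e t => rfl
  refine ⟨φ, ⟨fun h0 => hx0 ?_, G.continuous_liftEdges l _ _ _ _ (continuous_wave l k x),
    fun e t => Complex.I * k * waveDeriv l k x e t, fun e t => -(k : ℂ) ^ 2 * wave l k x e t,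
    fun e => ?_, fun e t => ?_, fun e t => ?_, fun v => ?_, fun e => ?_⟩, hφ⟩
  · -- the wave and its derivative vanish at the midpoint of the edge
    have hz : ∀ e, x (e, false) = 0 ∧ x (e, true) = 0 := by
      intro e
      have hev : wave l k x e =ᶠ[𝓝 0] fun _ => 0 := by
        have hl := length_pos l e
        filter_upwards [Icc_mem_nhds (by linarith : -(l e : ℝ) / 2 < 0)
          (by linarith : (0 : ℝ) < (l e : ℝ) / 2)] with t ht
        rw [← hφ e ⟨t, ht⟩, h0]; rfl
      have h1 := hev.eq_of_nhds
      have h2 := hev.deriv_eq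
      rw [(hasDerivAt_wave l k x e 0).deriv, deriv_const] at h2
      have h3 := (mul_eq_zero.1 h2).resolve_left hIk
      have he := Complex.exp_ne_zero ((k * ((l e : ℝ) / 2) : ℝ) * Complex.I)
      simp only [wave, waveDeriv, zero_add, sub_zero] at h1 h3
      constructor <;> apply mul_right_cancel₀ he
      · linear_combination (h1 + h3) / 2
      · linear_combination (h1 - h3) / 2
    ext ⟨e, b | b⟩
    · exact (hz e).1
    · exact (hz e).2
  · refine MemLp.of_bound (((continuous_wave l k x e).const_mul _).aestronglyMeasurable)
      (k ^ 2 * (‖x (e, false)‖ + ‖x (e, true)‖)) (Eventually.of_forall fun t => ?_)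
    rw [norm_mul, norm_neg, norm_pow, Complex.norm_real, Real.norm_eq_abs, sq_abs]
    exact mul_le_mul_of_nonneg_left (norm_wave_le l k x e t) (sq_nonneg k)
  · have hd : ∀ s, HasDerivAt (fun t => Complex.I * k * waveDeriv l k x e t)
        (-(k : ℂ) ^ 2 * wave l k x e s) s := fun s =>
      ((hasDerivAt_waveDeriv l k x e s).const_mul _).congr_deriv (by
        linear_combination (k : ℂ) ^ 2 * wave l k x e s * Complex.I_sq)
    rw [intervalIntegral.integral_eq_sub_of_hasDerivAt (fun s _ => hd s)
      (((continuous_wave l k x e).const_mul _).intervalIntegrable _ _)]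
    ring
  · rw [intervalIntegral.integral_eq_sub_of_hasDerivAt (fun s _ => hasDerivAt_wave l k x e s)
      (((continuous_waveDeriv l k x e).const_mul _).intervalIntegrable _ _), hφ, hφ]
    simp [leftEnd]
  · rw [← mul_zero (Complex.I * k), ← hkir v,
      show (∑ h with G.vert h = v, (x h - edgePhases l k h.1 * x (opposite h))) = _ from
      (Finset.sum_congr (by congr) fun _ _ => rfl).trans (sum_vert v _), mul_add, Finset.mul_sum,
      Finset.mul_sum]
    congr 1
    · refine Finset.sum_congr (by congr) fun e _ => ?_
      simp only [waveDeriv_left, opposite_mk, Bool.not_false]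
    · refine Finset.sum_congr (by congr) fun e _ => ?_
      simp only [waveDeriv_right, opposite_mk, Bool.not_true]
      ring
  · refine Eventually.of_forall fun t => ?_
    simp only [hφ]
    push_cast
    ring

end Fintype

end OrientedMultigraph

namespace OrientedMultigraph

variable {V E : Type*} {G : OrientedMultigraph V E} {l : Lengths E}

/-! ### Weak limits of the measures of eigenfunctions -/

/-- A function on `|G|`, seen on the edge `e` and extended by constants to the real line. -/
noncomputable def onEdge (f : G.Realization l → ℝ) (e : E) : ℝ → ℝ :=
  Set.IccExtend (half_nonneg l e) fun t => f (G.edgeMap l e t)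

lemma onEdge_coe (f : G.Realization l → ℝ) (e : E) (t : EdgeInterval l e) :
    onEdge f e t = f (G.edgeMap l e t) :=
  Set.IccExtend_of_mem _ _ t.2

lemma continuous_onEdge {f : G.Realization l → ℝ} (hf : Continuous f) (e : E) :
    Continuous (onEdge f e) :=
  (hf.comp (G.continuous_edgeMap l e)).Icc_extend'

lemma integral_edgeMeasure {f : G.Realization l → ℝ} (hf : Continuous f) {e : E} {F : ℝ → ℝ}
    (hF : ∀ t : EdgeInterval l e, f (G.edgeMap l e t) = F t) :
    ∫ p, f p ∂(G.edgeMeasure l e : Measure (G.Realization l)) =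
      ∫ t in Set.Icc (-(l e : ℝ) / 2) ((l e : ℝ) / 2), F t := by
  rw [coe_edgeMeasure, integral_map (G.measurable_edgeMap l e).aemeasurable
    hf.measurable.aestronglyMeasurable]
  simp only [hF]
  exact integral_subtype_comap measurableSet_Icc F

/-- The Riemann–Lebesgue lemma on an interval. -/
lemma tendsto_integral_mul_exp {a b : ℝ} {F : ℝ → ℝ} {k : ℕ → ℝ}
    (hk : Tendsto (fun j => |k j|) atTop atTop) :
    Tendsto (fun j => ∫ t in Set.Icc a b, (F t : ℂ) *
      Complex.exp ((2 * k j * t : ℝ) * Complex.I)) atTop (𝓝 0) := by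
  have hlim : Tendsto (fun j => -(k j / Real.pi)) atTop (cocompact ℝ) := by
    rw [← Metric.cobounded_eq_cocompact, ← tendsto_norm_atTop_iff_cobounded]
    simp only [norm_neg, norm_div, Real.norm_eq_abs, abs_of_pos Real.pi_pos]
    exact hk.atTop_div_const Real.pi_pos
  refine ((Real.tendsto_integral_exp_smul_cocompact
    ((Set.Icc a b).indicator fun t => (F t : ℂ))).comp hlim).congr fun j => ?_
  rw [← integral_indicator measurableSet_Icc]
  refine integral_congr_ae (Eventually.of_forall fun t => ?_)
  by_cases ht : t ∈ Set.Icc a b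
  · simp only [Set.indicator_of_mem ht, Circle.smul_def, Real.fourierChar_apply, smul_eq_mul]
    rw [mul_comm]
    congr 3
    have := Real.pi_ne_zero
    field_simp
  · simp [Set.indicator_of_notMem ht]

lemma norm_wave_sq (l : Lengths E) (k : ℝ) (x : E × Bool → ℂ) (e : E) (t : ℝ) :
    ‖wave l k x e t‖ ^ 2 = intensity x e + 2 * (x (e, false) * (starRingEnd ℂ) (x (e, true)) *
      Complex.exp ((2 * k * t : ℝ) * Complex.I)).re := by
  have hsq : ∀ u w : ℂ, ‖u + w‖ ^ 2 = ‖u‖ ^ 2 + ‖w‖ ^ 2 + 2 * (u * (starRingEnd ℂ) w).re := by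
    intro u w
    rw [← Complex.normSq_eq_norm_sq, ← Complex.normSq_eq_norm_sq, ← Complex.normSq_eq_norm_sq,
      Complex.normSq_add]
  rw [wave, hsq, norm_mul, norm_mul, Complex.norm_exp_ofReal_mul_I, Complex.norm_exp_ofReal_mul_I,
    mul_one, mul_one, coe_intensity, map_mul, ← Complex.exp_conj, map_mul, Complex.conj_I,
    Complex.conj_ofReal]
  congr 3
  rw [mul_mul_mul_comm, ← Complex.exp_add]
  congr 2
  push_cast
  ring

lemma wave_smul (l : Lengths E) (k : ℝ) (a : ℂ) (x : E × Bool → ℂ) (e : E) (t : ℝ) :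
    wave l k (a • x) e t = a * wave l k x e t := by
  simp only [wave, Pi.smul_apply, smul_eq_mul]
  ring

/-- As the frequency tends to infinity, the interference term in the squared modulus of a wave
oscillates, and only the intensity remains. -/
lemma tendsto_integral_wave {e : E} {F : ℝ → ℝ} (hF : Continuous F) {k : ℕ → ℝ}
    (hk : Tendsto (fun j => |k j|) atTop atTop) {x : ℕ → E × Bool → ℂ} {y : E × Bool → ℂ}
    (hx : Tendsto x atTop (𝓝 y)) :
    Tendsto (fun j => ∫ t in Set.Icc (-(l e : ℝ) / 2) ((l e : ℝ) / 2),
      F t * ‖wave l (k j) (x j) e t‖ ^ 2) atTop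
      (𝓝 (intensity y e * ∫ t in Set.Icc (-(l e : ℝ) / 2) ((l e : ℝ) / 2), F t)) := by
  have hxe : ∀ b, Tendsto (fun j => x j (e, b)) atTop (𝓝 (y (e, b))) := fun b =>
    tendsto_pi_nhds.1 hx (e, b)
  have hint : Tendsto (fun j => (intensity (x j) e : ℝ)) atTop (𝓝 (intensity y e)) :=
    (NNReal.continuous_coe.tendsto _).comp (((continuous_intensity e).tendsto y).comp hx)
  have hcross : Tendsto (fun j => x j (e, false) * (starRingEnd ℂ) (x j (e, true)) *
      ∫ t in Set.Icc (-(l e : ℝ) / 2) ((l e : ℝ) / 2), (F t : ℂ) *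
        Complex.exp ((2 * k j * t : ℝ) * Complex.I)) atTop (𝓝 0) := by
    have h := ((hxe false).mul ((Complex.continuous_conj.tendsto _).comp (hxe true))).mul
      (tendsto_integral_mul_exp (a := -(l e : ℝ) / 2) (b := (l e : ℝ) / 2) (F := F) hk)
    simpa using h
  have hre := (Complex.continuous_re.tendsto 0).comp hcross
  have hsum := (hint.mul_const (∫ t in Set.Icc (-(l e : ℝ) / 2) ((l e : ℝ) / 2), F t)).add
    (hre.const_mul 2)
  simp only [Complex.zero_re, mul_zero, add_zero] at hsum
  refine hsum.congr fun j => ?_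
  have hFi : IntegrableOn F (Set.Icc (-(l e : ℝ) / 2) ((l e : ℝ) / 2)) :=
    hF.continuousOn.integrableOn_Icc
  have hGc : Continuous fun t : ℝ => x j (e, false) * (starRingEnd ℂ) (x j (e, true)) *
      ((F t : ℂ) * Complex.exp ((2 * k j * t : ℝ) * Complex.I)) := by fun_prop
  have hGi : IntegrableOn (fun t : ℝ => x j (e, false) * (starRingEnd ℂ) (x j (e, true)) *
      ((F t : ℂ) * Complex.exp ((2 * k j * t : ℝ) * Complex.I)))
      (Set.Icc (-(l e : ℝ) / 2) ((l e : ℝ) / 2)) := hGc.continuousOn.integrableOn_Icc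
  have hpt : ∀ t, F t * ‖wave l (k j) (x j) e t‖ ^ 2 = intensity (x j) e * F t + 2 *
      (x j (e, false) * (starRingEnd ℂ) (x j (e, true)) *
      ((F t : ℂ) * Complex.exp ((2 * k j * t : ℝ) * Complex.I))).re := by
    intro t
    rw [norm_wave_sq, mul_left_comm _ (F t : ℂ), Complex.re_ofReal_mul]
    ring
  have hGr : IntegrableOn (fun t : ℝ => (x j (e, false) * (starRingEnd ℂ) (x j (e, true)) *
      ((F t : ℂ) * Complex.exp ((2 * k j * t : ℝ) * Complex.I))).re)
      (Set.Icc (-(l e : ℝ) / 2) ((l e : ℝ) / 2)) := Integrable.re hGi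
  simp only [hpt, Function.comp_apply]
  rw [integral_add (hFi.const_mul _) (hGr.const_mul 2), integral_const_mul,
    integral_const_mul, ← integral_const_mul (x j (e, false) * (starRingEnd ℂ) (x j (e, true)))]
  congr 2
  exact (integral_re hGi).symm

section Fintype

variable [Fintype E]

/-- The integral of `f` against the measure of the sum of waves with amplitudes `x`. -/
noncomputable def waveIntegral (l : Lengths E) (k : ℝ) (x : E × Bool → ℂ) (F : E → ℝ → ℝ) : ℝ :=
  ∑ e, ∫ t in Set.Icc (-(l e : ℝ) / 2) ((l e : ℝ) / 2), F e t * ‖wave l k x e t‖ ^ 2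

lemma waveIntegral_smul (k : ℝ) (a : ℂ) (x : E × Bool → ℂ) (F : E → ℝ → ℝ) :
    waveIntegral l k (a • x) F = ‖a‖ ^ 2 * waveIntegral l k x F := by
  rw [waveIntegral, waveIntegral, Finset.mul_sum]
  refine Finset.sum_congr rfl fun e _ => ?_
  rw [← integral_const_mul]
  refine integral_congr_ae (Eventually.of_forall fun t => ?_)
  simp only [wave_smul, norm_mul]
  ring

lemma integrable_of_continuous [Finite V] {f : G.Realization l → ℝ} (hf : Continuous f)
    (μ : Measure (G.Realization l)) [IsFiniteMeasure μ] : Integrable f μ :=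
  hf.integrable_of_hasCompactSupport (HasCompactSupport.of_compactSpace f)

lemma integral_eigenMeasure [Finite V] {φ : G.Realization l → ℂ} (hφ : Continuous φ) {k : ℝ}
    {x : E × Bool → ℂ} (hwave : ∀ e t, φ (G.edgeMap l e t) = wave l k x e t)
    {f : G.Realization l → ℝ} (hf : Continuous f) :
    ∫ p, f p ∂G.eigenMeasure l φ = waveIntegral l k x (onEdge f) := by
  rw [eigenMeasure, integral_withDensity_eq_integral_toReal_smul
    (hφ.measurable.enorm.pow_const 2) (Eventually.of_forall fun p => by simp)]
  have hcont : Continuous fun p => f p * ‖φ p‖ ^ 2 := by fun_prop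
  have heq : ∀ p, (‖φ p‖ₑ ^ 2).toReal • f p = f p * ‖φ p‖ ^ 2 := fun p => by
    rw [ENNReal.toReal_pow, toReal_enorm, smul_eq_mul, mul_comm]
  simp only [heq]
  rw [subgraphMeasure, FiniteMeasure.toMeasure_sum, integral_finsetSum_measure
    fun e _ => integrable_of_continuous hcont _]
  refine Finset.sum_congr rfl fun e _ => integral_edgeMeasure hcont fun t => ?_
  rw [hwave, onEdge_coe]

lemma integral_edgewiseMeasure [Finite V] (m : E → ℝ≥0) {f : G.Realization l → ℝ}
    (hf : Continuous f) :
    ∫ p, f p ∂(G.edgewiseMeasure l m : Measure (G.Realization l)) =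
      ∑ e, m e * ∫ t in Set.Icc (-(l e : ℝ) / 2) ((l e : ℝ) / 2), onEdge f e t := by
  have hi : ∀ e, Integrable f ((m e : ℝ≥0∞) • (G.edgeMeasure l e : Measure (G.Realization l))) :=
    fun e => (integrable_of_continuous hf _).smul_measure ENNReal.coe_ne_top
  rw [coe_edgewiseMeasure, integral_finsetSum_measure fun e _ => hi e]
  refine Finset.sum_congr rfl fun e _ => ?_
  rw [integral_smul_measure, integral_edgeMeasure hf fun t => (onEdge_coe f e t).symm]
  rfl

lemma tendsto_waveIntegral [Finite V] {f : G.Realization l → ℝ} (hf : Continuous f) {k : ℕ → ℝ}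
    (hk : Tendsto (fun j => |k j|) atTop atTop) {x : ℕ → E × Bool → ℂ} {y : E × Bool → ℂ}
    (hx : Tendsto x atTop (𝓝 y)) :
    Tendsto (fun j => waveIntegral l (k j) (x j) (onEdge f)) atTop
      (𝓝 (∫ p, f p ∂(G.edgewiseMeasure l (intensity y) : Measure (G.Realization l)))) := by
  rw [integral_edgewiseMeasure _ hf]
  exact tendsto_finsetSum _ fun e _ => tendsto_integral_wave (continuous_onEdge hf e) hk hx

lemma isFiniteMeasure_eigenMeasure [Finite V] {φ : G.Realization l → ℂ} (hφ : Continuous φ) :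
    IsFiniteMeasure (G.eigenMeasure l φ) := by
  refine isFiniteMeasure_withDensity ?_
  obtain ⟨C, hC⟩ := (isCompact_range hφ.norm).bddAbove
  have hle : ∀ p, ‖φ p‖ₑ ^ 2 ≤ ENNReal.ofReal C ^ 2 := fun p => by
    gcongr
    rw [← ofReal_norm]
    exact ENNReal.ofReal_le_ofReal (hC ⟨p, rfl⟩)
  refine ((lintegral_mono hle).trans_lt ?_).ne
  rw [lintegral_const]
  exact ENNReal.mul_lt_top (by finiteness) (measure_lt_top _ _)

/-- Waves with normalized amplitudes have convergent subsequences. -/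
lemma exists_subseq_vertexConditions {k : ℕ → ℝ} {x : ℕ → E × Bool → ℂ}
    (hx1 : ∀ j, ‖x j‖ = 1) (hx : ∀ j, G.VertexConditions (edgePhases l (k j)) (x j)) :
    ∃ (σ : ℕ → ℕ) (z : E → ℂ) (y : E × Bool → ℂ), StrictMono σ ∧
      Tendsto (fun j => edgePhases l (k (σ j))) atTop (𝓝 z) ∧
      Tendsto (fun j => x (σ j)) atTop (𝓝 y) ∧
      (∀ e, ‖z e‖ = 1) ∧ y ≠ 0 ∧ G.VertexConditions z y := by
  have hmem : ∀ j, (edgePhases l (k j), x j) ∈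
      Metric.closedBall (0 : (E → ℂ) × (E × Bool → ℂ)) 1 := by
    intro j
    rw [mem_closedBall_zero_iff, Prod.norm_def, max_le_iff]
    exact ⟨(pi_norm_le_iff_of_nonneg zero_le_one).2 fun e => (norm_phases _ _ _).le, (hx1 j).le⟩
  obtain ⟨⟨z, y⟩, -, σ, hσ, hlim⟩ := (isCompact_closedBall _ _).tendsto_subseq hmem
  have hz : Tendsto (fun j => edgePhases l (k (σ j))) atTop (𝓝 z) :=
    (continuous_fst.tendsto _).comp hlim
  have hy : Tendsto (fun j => x (σ j)) atTop (𝓝 y) := (continuous_snd.tendsto _).comp hlim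
  have hy1 : ‖y‖ = 1 :=
    tendsto_nhds_unique hy.norm (by simp only [hx1]; exact tendsto_const_nhds)
  refine ⟨σ, z, y, hσ, hz, hy, fun e => ?_, fun h => by simp [h] at hy1, ?_⟩
  · exact tendsto_nhds_unique (tendsto_pi_nhds.1 hz e).norm
      (by simp only [norm_phases]; exact tendsto_const_nhds)
  · rw [← secularMatrix_mulVec_eq_zero_iff]
    have hc : Continuous fun q : (E → ℂ) × (E × Bool → ℂ) => (G.secularMatrix q.1).mulVec q.2 :=
      ((continuous_secularMatrix G).comp continuous_fst).matrix_mulVec continuous_snd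
    refine tendsto_nhds_unique ((hc.tendsto (z, y)).comp hlim) ?_
    refine tendsto_const_nhds.congr fun j => ?_
    exact (secularMatrix_mulVec_eq_zero_iff.2 (hx (σ j))).symm

/-- Every semi-classical measure has constant densities on the edges; these are the intensities of
a wave, for suitable phases. -/
theorem exists_intensity_of_mem_semiclassicalMeasures [Finite V]
    {μ : FiniteMeasure (G.Realization l)} (hμ : μ ∈ G.semiclassicalMeasures l) :
    ∃ (z : E → ℂ) (x : E × Bool → ℂ), (∀ e, ‖z e‖ = 1) ∧ x ≠ 0 ∧ G.VertexConditions z x ∧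
      μ = G.edgewiseMeasure l (intensity x) := by
  obtain ⟨hμ0, k, φ, ν, hφ, hk, hν, hlim⟩ := hμ
  obtain ⟨N, hN⟩ := eventually_atTop.1 (hk.eventually_ge_atTop 1)
  have hk0 : ∀ j, k (j + N) ≠ 0 := fun j h => by
    have := hN (j + N) (by omega)
    rw [h] at this
    norm_num at this
  choose x hx0 hx hwave using fun j => (hφ (j + N)).exists_wave (hk0 j)
  have hnorm : ∀ j, (‖x j‖ : ℂ) ≠ 0 := fun j => by simpa using hx0 j
  obtain ⟨σ, z, y, hσ, -, hy, hz, hy0, hzy⟩ := exists_subseq_vertexConditions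
    (k := fun j => k (j + N)) (x := fun j => (‖x j‖ : ℂ)⁻¹ • x j) (fun j => by
      have := hnorm j
      rw [norm_smul, norm_inv, Complex.norm_real, norm_norm]
      exact inv_mul_cancel₀ (by exact_mod_cast this)) (fun j => (hx j).smul _)
  let τ : ℕ → ℕ := fun j => σ j + N
  have hτ : Tendsto τ atTop atTop :=
    tendsto_atTop_mono (fun j => Nat.le_add_right (σ j) N) hσ.tendsto_atTop
  have hkτ : Tendsto (fun j => |k (τ j)|) atTop atTop := by
    have h := Real.tendsto_sqrt_atTop.comp (hk.comp hτ)
    refine h.congr fun j => ?_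
    simp [Real.sqrt_sq_eq_abs]
  have hlimτ := hlim.comp hτ
  rw [FiniteMeasure.tendsto_iff_forall_integral_tendsto] at hlimτ
  -- the measures of the eigenfunctions, in terms of the normalized waves
  let J : (BoundedContinuousFunction (G.Realization l) ℝ) → ℕ → ℝ := fun f j =>
    waveIntegral l (k (τ j)) ((‖x (σ j)‖ : ℂ)⁻¹ • x (σ j)) (onEdge f)
  have hJ : ∀ f, Tendsto (J f) atTop (𝓝 (∫ p, f p ∂(G.edgewiseMeasure l (intensity y) :
      Measure (G.Realization l)))) := fun f => tendsto_waveIntegral f.continuous hkτ hy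
  have hνJ : ∀ f j, ∫ p, f p ∂(ν (τ j) : Measure (G.Realization l)) = ‖x (σ j)‖ ^ 2 * J f j := by
    intro f j
    rw [hν, integral_eigenMeasure (hφ _).2.1 (hwave (σ j)) f.continuous]
    have hxx : x (σ j) = (‖x (σ j)‖ : ℂ) • ((‖x (σ j)‖ : ℂ)⁻¹ • x (σ j)) := by
      rw [smul_smul, mul_inv_cancel₀ (hnorm _), one_smul]
    conv_lhs => rw [hxx]
    rw [waveIntegral_smul, Complex.norm_real, norm_norm]
  -- comparing the total masses, one sees that the normalizing factors converge
  let one : BoundedContinuousFunction (G.Realization l) ℝ := BoundedContinuousFunction.const _ 1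
  have hone : ∀ μ : FiniteMeasure (G.Realization l),
      ∫ p, one p ∂(μ : Measure (G.Realization l)) = μ.mass := fun μ => by
    change ∫ _, (1 : ℝ) ∂(μ : Measure (G.Realization l)) = μ.mass
    rw [integral_const, smul_eq_mul, mul_one]
    rfl
  obtain ⟨e, he⟩ := edgeSupport_nonempty hy0
  have hne : G.edgewiseMeasure l (intensity y) ≠ 0 :=
    G.edgewiseMeasure_ne_zero (e := e) fun h => intensity_eq_zero.1 h he
  have hmass : ((G.edgewiseMeasure l (intensity y)).mass : ℝ) ≠ 0 :=
    NNReal.coe_ne_zero.2 ((FiniteMeasure.mass_nonzero_iff _).2 hne)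
  let c : ℝ≥0 := μ.mass / (G.edgewiseMeasure l (intensity y)).mass
  have hc0 : c ≠ 0 := div_ne_zero ((FiniteMeasure.mass_nonzero_iff _).2 hμ0)
    ((FiniteMeasure.mass_nonzero_iff _).2 hne)
  have hJ1 := hJ one
  have hμ1 := hlimτ one
  rw [hone] at hJ1 hμ1
  have hfac : Tendsto (fun j => ‖x (σ j)‖ ^ 2) atTop (𝓝 (c : ℝ)) := by
    have h := hμ1.div hJ1 hmass
    rw [NNReal.coe_div]
    refine h.congr' ?_
    filter_upwards [hJ1.eventually_ne hmass] with j hj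
    simp only [Pi.div_apply, Function.comp_apply]
    rw [hνJ, mul_div_cancel_right₀ _ hj]
  have hμeq : μ = c • G.edgewiseMeasure l (intensity y) := by
    refine FiniteMeasure.ext_of_forall_integral_eq fun f => ?_
    refine tendsto_nhds_unique (hlimτ f) ?_
    simp only [Function.comp_apply, hνJ]
    have h := hfac.mul (hJ f)
    rwa [FiniteMeasure.toMeasure_smul, integral_smul_nnreal_measure]
  let a : ℂ := ((NNReal.sqrt c : ℝ≥0) : ℝ)
  have ha : ‖a‖₊ ^ 2 = c := by
    simp only [a]
    rw [Complex.nnnorm_real, NNReal.nnnorm_eq, NNReal.sq_sqrt]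
  have ha0 : a ≠ 0 := fun h => hc0 (by rw [← ha, h]; simp)
  refine ⟨z, a • y, hz, smul_ne_zero ha0 hy0, hzy.smul a, ?_⟩
  rw [hμeq, ← edgewiseMeasure_smul]
  congr 1
  ext e
  rw [intensity_smul, ha]

/-- If the lengths are independent over `ℚ` and there is a non-zero wave for the phases `z`, there
is one whose intensities are the densities of a semi-classical measure, and so are those of its
multiples. -/
theorem exists_edgewiseMeasure_mem_semiclassicalMeasures [Fintype V] (hl : l.IsIrrational)
    {z : E → ℂ} (hz : ∀ e, ‖z e‖ = 1) {x : E × Bool → ℂ} (hx0 : x ≠ 0)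
    (hx : G.VertexConditions z x) :
    ∃ y, y ≠ 0 ∧ G.VertexConditions z y ∧ ∀ a : ℂ, a ≠ 0 →
      G.edgewiseMeasure l (intensity (a • y)) ∈ G.semiclassicalMeasures l := by
  have hstep : ∀ j : ℕ, ∃ k : ℝ, (j : ℝ) + 1 ≤ k ∧ edgePhases l k ∈ Metric.ball z (1 / (j + 1)) ∧
      ∃ y : E × Bool → ℂ, y ≠ 0 ∧ G.VertexConditions (edgePhases l k) y := fun j => by
    obtain ⟨k, hk, hkz, hy⟩ := frequently_atTop.1 (frequently_vertexConditions
      (fun e => length_pos l e) hl hz hx0 hx (Metric.ball_mem_nhds z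
        (by positivity : (0 : ℝ) < 1 / (j + 1)))) ((j : ℝ) + 1)
    exact ⟨k, hk, hkz, hy⟩
  choose k hk hkz w hw0 hw using hstep
  have hnorm : ∀ j, (‖w j‖ : ℂ) ≠ 0 := fun j => by simpa using hw0 j
  obtain ⟨σ, z', y, hσ, hz', hy, -, hy0, hzy⟩ := exists_subseq_vertexConditions (k := k)
    (x := fun j => (‖w j‖ : ℂ)⁻¹ • w j) (fun j => by
      have := hnorm j
      rw [norm_smul, norm_inv, Complex.norm_real, norm_norm]
      exact inv_mul_cancel₀ (by exact_mod_cast this)) (fun j => (hw j).smul _)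
  have hzlim : Tendsto (fun j => edgePhases l (k j)) atTop (𝓝 z) := by
    rw [tendsto_iff_dist_tendsto_zero]
    exact squeeze_zero (fun _ => dist_nonneg) (fun j => (Metric.mem_ball.1 (hkz j)).le)
      tendsto_one_div_add_atTop_nhds_zero_nat
  obtain rfl : z' = z := tendsto_nhds_unique hz' (hzlim.comp hσ.tendsto_atTop)
  refine ⟨y, hy0, hzy, fun a ha => ⟨?_, ?_⟩⟩
  · obtain ⟨e, he⟩ := edgeSupport_nonempty (smul_ne_zero ha hy0)
    exact G.edgewiseMeasure_ne_zero (e := e) fun h => intensity_eq_zero.1 h he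
  have hkpos : ∀ j, 0 < k j := fun j => by
    have := hk j
    have : (0 : ℝ) ≤ j := Nat.cast_nonneg j
    linarith [hk j]
  have hktop : Tendsto (fun j => k (σ j)) atTop atTop := by
    refine Tendsto.comp (tendsto_atTop_mono (fun j => ?_) tendsto_natCast_atTop_atTop)
      hσ.tendsto_atTop
    linarith [hk j]
  choose φ hφ hφw using fun j => VertexConditions.exists_isEigenfunction (hkpos (σ j)).ne'
    (smul_ne_zero ha (smul_ne_zero (inv_ne_zero (hnorm (σ j))) (hw0 (σ j))))
    (((hw (σ j)).smul _).smul a)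
  have hfin : ∀ j, IsFiniteMeasure (G.eigenMeasure l (φ j)) := fun j =>
    isFiniteMeasure_eigenMeasure (hφ j).2.1
  let ν : ℕ → FiniteMeasure (G.Realization l) := fun j => ⟨G.eigenMeasure l (φ j), hfin j⟩
  have hνφ : ∀ j, (ν j : Measure (G.Realization l)) = G.eigenMeasure l (φ j) := fun j => rfl
  refine ⟨fun j => k (σ j), φ, ν, hφ, (tendsto_pow_atTop two_ne_zero).comp hktop, hνφ, ?_⟩
  refine FiniteMeasure.tendsto_iff_forall_integral_tendsto.2 fun f => ?_
  refine (tendsto_waveIntegral f.continuous (tendsto_abs_atTop_atTop.comp hktop)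
    (hy.const_smul a)).congr fun j => ?_
  rw [hνφ]
  exact (integral_eigenMeasure (hφ j).2.1 (hφw j) f.continuous).symm

end Fintype

end OrientedMultigraph

/-! ### Genericity of irrational lengths -/

lemma isIrrational_iff {E : Type*} [Fintype E] {l : Lengths E} :
    l.IsIrrational ↔ ∀ q : E → ℚ, q ≠ 0 → ∑ e, (q e : ℝ) * l e ≠ 0 := by
  rw [Lengths.IsIrrational, Fintype.linearIndependent_iff]
  simp only [Rat.smul_def]
  refine forall_congr' fun q => ⟨fun h hq h0 => hq (funext (h h0)), fun h h0 => ?_⟩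
  by_contra hne
  exact h (fun hq => hne (congrFun hq)) h0

theorem isIrrational_mem_residual (E : Type*) [Fintype E] :
    {l : Lengths E | l.IsIrrational} ∈ residual (Lengths E) := by
  classical
  have heq : {l : Lengths E | l.IsIrrational} =
      ⋂ q : {q : E → ℚ // q ≠ 0}, {l : Lengths E | ∑ e, (q.1 e : ℝ) * l e ≠ 0} := by
    ext l
    simp [isIrrational_iff]
  rw [heq, countable_iInter_mem]
  rintro ⟨q, hq⟩
  have hcont : Continuous fun l : Lengths E => ∑ e, (q e : ℝ) * l e := by fun_prop
  refine residual_of_dense_open (isOpen_ne_fun hcont continuous_const) fun l => ?_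
  by_cases h0 : ∑ e, (q e : ℝ) * l e = 0
  · obtain ⟨e₀, he₀⟩ := Function.ne_iff.1 hq
    have hpos : ∀ n : ℕ, (0 : ℝ) < 1 / ((n : ℝ) + 1) := fun n => by positivity
    -- perturb the length of an edge on which the relation depends
    let u : ℕ → Lengths E := fun n => Function.update l e₀
      ⟨l e₀ + 1 / ((n : ℝ) + 1), by
        have h1 : (0 : ℝ) < l e₀ := (l e₀).2
        have := hpos n
        simp only [Set.mem_Ioi]
        linarith⟩
    have hu : Tendsto u atTop (𝓝 l) := by
      rw [tendsto_pi_nhds]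
      intro e
      rcases eq_or_ne e e₀ with rfl | he
      · rw [tendsto_subtype_rng]
        have := (tendsto_one_div_add_atTop_nhds_zero_nat (𝕜 := ℝ)).const_add (l e : ℝ)
        simpa [u] using this
      · simp [u, he]
    refine mem_closure_of_tendsto hu (Eventually.of_forall fun n => ?_)
    have hval : ∑ e, (q e : ℝ) * u n e = ∑ e, (q e : ℝ) * l e + q e₀ * (1 / ((n : ℝ) + 1)) := by
      rw [← sub_eq_iff_eq_add', ← Finset.sum_sub_distrib, Finset.sum_eq_single e₀]
      · simp only [u, Function.update_self]; ring
      · intro e _ he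
        simp [u, he]
      · simp
    change ∑ e, (q e : ℝ) * u n e ≠ 0
    rw [hval, h0, zero_add]
    exact mul_ne_zero (by exact_mod_cast he₀) (hpos n).ne'
  · exact subset_closure h0

namespace OrientedMultigraph

variable {V E : Type*} {G : OrientedMultigraph V E} {l : Lengths E}

/-! ### Minimal supports -/

lemma exists_isChain {γ : Finset E} (h : G.IsSimpleCycle γ ∨ G.IsSimpleLeafPath γ) :
    ∃ n a, G.IsChain γ n a :=
  h.elim IsSimpleCycle.exists_isChain IsSimpleLeafPath.exists_isChain

lemma IsChain.mass_ne_zero {γ : Finset E} {n : ℕ} {a : ℕ → E × Bool} (h : G.IsChain γ n a) :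
    (G.subgraphMeasure l γ).mass ≠ 0 :=
  G.mass_subgraphMeasure_ne_zero ⟨_, h.mem_edge (Nat.zero_le n)⟩

variable [Fintype V] [Fintype E]

lemma support_smul_subgraphMeasure (γ : Finset E) {c : ℝ≥0} (hc : c ≠ 0) :
    ((c • G.subgraphMeasure l γ : FiniteMeasure (G.Realization l)) :
      Measure (G.Realization l)).support = G.carrier l γ := by
  classical
  rw [← G.edgewiseMeasure_eq_smul (m := fun e => if e ∈ γ then c else 0) (γ := γ) (c := c)
    (fun e he => if_pos he) (fun e he => if_neg he), support_edgewiseMeasure]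
  congr 1
  ext e
  simp [hc]

/-- The uniform measures on simple cycles and on simple paths between leaves are semi-classical:
the phases outside `γ` are chosen in such a way that all the waves are supported in `γ`, and any
wave which arises as a limit of eigenfunctions for these phases has constant intensity there. -/
lemma IsChain.smul_subgraphMeasure_mem {γ : Finset E} {n : ℕ} {a : ℕ → E × Bool}
    (h : G.IsChain γ n a) (hl : l.IsIrrational) {c : ℝ≥0} (hc : c ≠ 0) :
    c • G.subgraphMeasure l γ ∈ G.semiclassicalMeasures l := by
  obtain ⟨z, x, hz, hx0, hx, hxγ⟩ := h.exists_vertexConditions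
  obtain ⟨z', hz', hzz', hsupp⟩ := exists_phases_edgeSupport_subset G (γ : Set E) hz
  have hx' : G.VertexConditions z' x := hx.congr fun e he => hzz' e (hxγ he)
  obtain ⟨y, hy0, hy, hmem⟩ :=
    exists_edgewiseMeasure_mem_semiclassicalMeasures hl hz' hx0 hx'
  obtain ⟨m, hm, hm1, hm2⟩ := h.exists_intensity_eq hy hz' hy0 (hsupp y hy)
  let b : ℂ := ((NNReal.sqrt (c / m) : ℝ≥0) : ℝ)
  have hb : ‖b‖₊ ^ 2 = c / m := by
    simp only [b]
    rw [Complex.nnnorm_real, NNReal.nnnorm_eq, NNReal.sq_sqrt]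
  have hb0 : b ≠ 0 := fun h0 => div_ne_zero hc hm (by rw [← hb, h0]; simp)
  rw [← G.edgewiseMeasure_eq_smul (m := intensity (b • y))]
  · exact hmem b hb0
  · intro e he
    rw [intensity_smul, hb, hm1 e he, div_mul_cancel₀ _ hm]
  · intro e he
    rw [intensity_smul, hm2 e he, mul_zero]

/-- A semi-classical measure which is carried by a simple cycle, or by a simple path between leaves,
is uniform on it. -/
lemma IsChain.exists_eq_smul_subgraphMeasure {γ : Finset E} {n : ℕ} {a : ℕ → E × Bool}
    (h : G.IsChain γ n a) {μ : FiniteMeasure (G.Realization l)}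
    (hμ : μ ∈ G.semiclassicalMeasures l)
    (hsupp : (μ : Measure (G.Realization l)).support ⊆ G.carrier l γ) :
    ∃ c : ℝ≥0, c ≠ 0 ∧ μ = c • G.subgraphMeasure l γ := by
  classical
  obtain ⟨z, x, hz, hx0, hx, rfl⟩ := exists_intensity_of_mem_semiclassicalMeasures hμ
  rw [support_edgewiseMeasure, carrier_subset_carrier_iff] at hsupp
  have hxγ : edgeSupport x ⊆ γ := fun e he => hsupp (by
    simp only [Finset.mem_filter, Finset.mem_univ, true_and]
    exact fun h0 => intensity_eq_zero.1 h0 he)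
  obtain ⟨m, hm, hm1, hm2⟩ := h.exists_intensity_eq hx hz hx0 hxγ
  exact ⟨m, hm, G.edgewiseMeasure_eq_smul hm1 hm2⟩

/-- The support of a semi-classical measure contains a simple cycle or a simple path between
leaves. -/
lemma exists_carrier_subset_support {μ : FiniteMeasure (G.Realization l)}
    (hμ : μ ∈ G.semiclassicalMeasures l) :
    ∃ γ : Finset E, (G.IsSimpleCycle γ ∨ G.IsSimpleLeafPath γ) ∧
      G.carrier l γ ⊆ (μ : Measure (G.Realization l)).support := by
  classical
  obtain ⟨z, x, hz, hx0, hx, rfl⟩ := exists_intensity_of_mem_semiclassicalMeasures hμ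
  obtain ⟨γ, hγ, hγx⟩ := exists_cycle_or_leafPath_subset (edgeSupport_nonempty hx0)
    fun h hh hd => hx.exists_ne_mem_edgeSupport hz hh hd
  refine ⟨γ, hγ, ?_⟩
  rw [support_edgewiseMeasure, carrier_subset_carrier_iff]
  intro e he
  simp only [Finset.mem_filter, Finset.mem_univ, true_and]
  exact fun h0 => intensity_eq_zero.1 h0 (hγx he)

lemma IsChain.isSemiclassicalSupport {γ : Finset E} {n : ℕ} {a : ℕ → E × Bool}
    (h : G.IsChain γ n a) (hl : l.IsIrrational) :
    G.IsSemiclassicalSupport l (G.carrier l γ) :=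
  ⟨_, h.smul_subgraphMeasure_mem hl one_ne_zero, support_smul_subgraphMeasure γ one_ne_zero⟩

theorem minimal_isSemiclassicalSupport_iff (hl : l.IsIrrational) (K : Set (G.Realization l)) :
    Minimal (G.IsSemiclassicalSupport l) K ↔
      ∃ γ : Finset E, (G.IsSimpleCycle γ ∨ G.IsSimpleLeafPath γ) ∧ K = G.carrier l γ := by
  constructor
  · rintro ⟨⟨μ, hμ, rfl⟩, hmin⟩
    obtain ⟨γ, hγ, hsub⟩ := exists_carrier_subset_support hμ
    obtain ⟨n, a, h⟩ := exists_isChain hγ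
    exact ⟨γ, hγ, Set.Subset.antisymm (hmin (h.isSemiclassicalSupport hl) hsub) hsub⟩
  · rintro ⟨γ, hγ, rfl⟩
    obtain ⟨n, a, h⟩ := exists_isChain hγ
    refine ⟨h.isSemiclassicalSupport hl, ?_⟩
    rintro K' ⟨μ, hμ, rfl⟩ hle
    obtain ⟨c, hc, rfl⟩ := h.exists_eq_smul_subgraphMeasure hμ hle
    rw [support_smul_subgraphMeasure γ hc]

/-- A semi-classical probability measure which is carried by a simple cycle, or by a simple path
between leaves, is the uniform one. -/
lemma IsChain.eq_uniformMeasure {γ : Finset E} {n : ℕ} {a : ℕ → E × Bool} (h : G.IsChain γ n a)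
    {μ : FiniteMeasure (G.Realization l)} (hμ : μ ∈ G.semiclassicalProbabilities l)
    (hsupp : (μ : Measure (G.Realization l)).support ⊆ G.carrier l γ) :
    μ = G.uniformMeasure l γ := by
  obtain ⟨c, -, rfl⟩ := h.exists_eq_smul_subgraphMeasure hμ.1 hsupp
  have h1 : c * (G.subgraphMeasure l γ).mass = 1 := by
    have := hμ.2
    rwa [FiniteMeasure.mass, FiniteMeasure.smul_apply] at this
  rw [uniformMeasure, eq_inv_of_mul_eq_one_left h1]

lemma IsChain.uniformMeasure_mem {γ : Finset E} {n : ℕ} {a : ℕ → E × Bool}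
    (h : G.IsChain γ n a) (hl : l.IsIrrational) :
    G.uniformMeasure l γ ∈ G.semiclassicalProbabilities l := by
  refine ⟨h.smul_subgraphMeasure_mem hl (inv_ne_zero h.mass_ne_zero), ?_⟩
  rw [uniformMeasure, FiniteMeasure.mass, FiniteMeasure.smul_apply]
  exact inv_mul_cancel₀ h.mass_ne_zero

/-- The uniform measure is the only one in the convex hull of the semi-classical probability
measures which does not charge the complement of the carrier; hence it is extremal. -/
lemma IsChain.uniformMeasure_mem_extremePoints {γ : Finset E} {n : ℕ} {a : ℕ → E × Bool}
    (h : G.IsChain γ n a) (hl : l.IsIrrational) :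
    G.uniformMeasure l γ ∈
      Set.extremePoints ℝ≥0 (convexHull ℝ≥0 (G.semiclassicalProbabilities l)) := by
  have hadd : ∀ (a b : ℝ≥0) (μ ν : FiniteMeasure (G.Realization l)), 0 < a → 0 < b →
      (a • μ + b • ν) (G.carrier l γ)ᶜ = 0 →
        μ (G.carrier l γ)ᶜ = 0 ∧ ν (G.carrier l γ)ᶜ = 0 := by
    intro a b μ ν ha hb h0
    rw [FiniteMeasure.coeFn_add, Pi.add_apply, FiniteMeasure.smul_apply,
      FiniteMeasure.smul_apply] at h0
    simpa [ha.ne', hb.ne'] using h0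
  have huniq : convexHull ℝ≥0 (G.semiclassicalProbabilities l) ⊆
      {μ | μ (G.carrier l γ)ᶜ = 0 → μ = G.uniformMeasure l γ} := by
    refine convexHull_min (fun μ hμ h0 => h.eq_uniformMeasure hμ ?_) ?_
    · refine Measure.support_subset_of_isClosed (G.isClosed_carrier γ) ?_
      rw [mem_ae_iff]
      exact (FiniteMeasure.null_iff_toMeasure_null μ _).1 h0
    · rw [convex_iff_forall_pos]
      intro μ hμ ν hν a b ha hb hab h0
      obtain ⟨h1, h2⟩ := hadd a b μ ν ha hb h0
      rw [hμ h1, hν h2, ← add_smul, hab, one_smul]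
  have hnull : G.uniformMeasure l γ (G.carrier l γ)ᶜ = 0 := by
    rw [uniformMeasure, FiniteMeasure.smul_apply, FiniteMeasure.null_iff_toMeasure_null _ _ |>.2,
      smul_zero]
    rw [subgraphMeasure, FiniteMeasure.toMeasure_sum, Measure.finsetSum_apply]
    exact Finset.sum_eq_zero fun e he => G.edgeMeasure_compl_carrier he
  rw [mem_extremePoints]
  refine ⟨subset_convexHull ℝ≥0 _ (h.uniformMeasure_mem hl), fun μ hμ ν hν hseg => ?_⟩
  obtain ⟨a, b, ha, hb, -, hab⟩ := hseg
  rw [← hab] at hnull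
  obtain ⟨h1, h2⟩ := hadd a b μ ν ha hb hnull
  exact ⟨huniq hμ h1, huniq hν h2⟩

end OrientedMultigraph

theorem mainTheorem5 {V E : Type*} [Fintype V] [Fintype E] (G : OrientedMultigraph V E)
    (hG : G.IsConnected) :
    {l : Lengths E | l.IsIrrational} ∈ residual (Lengths E) ∧
    ∀ l : Lengths E, l.IsIrrational →
      (∀ K : Set (G.Realization l), Minimal (G.IsSemiclassicalSupport l) K ↔
        ∃ γ : Finset E, (G.IsSimpleCycle γ ∨ G.IsSimpleLeafPath γ) ∧ K = G.carrier l γ) ∧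
      (∀ γ : Finset E, G.IsSimpleCycle γ ∨ G.IsSimpleLeafPath γ →
        (∀ μ : FiniteMeasure (G.Realization l),
          (μ ∈ G.semiclassicalProbabilities l ∧
              (μ : Measure (G.Realization l)).support = G.carrier l γ) ↔
            μ = G.uniformMeasure l γ) ∧
        G.uniformMeasure l γ ∈
          Set.extremePoints ℝ≥0 (convexHull ℝ≥0 (G.semiclassicalProbabilities l))) := by
  refine ⟨isIrrational_mem_residual E, fun l hl =>
    ⟨OrientedMultigraph.minimal_isSemiclassicalSupport_iff hl, fun γ hγ => ?_⟩⟩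
  obtain ⟨n, a, h⟩ := OrientedMultigraph.exists_isChain hγ
  refine ⟨fun μ => ⟨fun ⟨hμ, hsupp⟩ => h.eq_uniformMeasure hμ hsupp.le, ?_⟩,
    h.uniformMeasure_mem_extremePoints hl⟩
  rintro rfl
  exact ⟨h.uniformMeasure_mem hl,
    OrientedMultigraph.support_smul_subgraphMeasure γ (inv_ne_zero h.mass_ne_zero)⟩
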